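/- **Theorem.** Let $N\ge 2$ and let $W:\mathbb C\to\mathbb R$, $W(z)=F(|z|)$ with $F\in C^2(\mathbb R,\mathbb R)$, satisfy $W(0)=W'(0)=0$, $W''(0)=1$ (that is, $F(0)=F'(0)=0$, $F''(0)=1$). Write $W(z)=\tfrac12|z|^2+R(|z|)$ and assume that there are constants $c_1,c_2>0$ and $2<p\le q<2^*$ (where $2^*=\frac{2N}{N-2}$ if $N\ge 3$ and $2^*=\infty$ if $N=2$) such that $|R''(s)|\le c_1 s^{p-2}+c_2 s^{q-2}$ for all $s\ge 0$. Put $W'(z)=F'(|z|)\,z/|z|$ for $z\ne0$, $W'(0)=0$, and consider the nonlinear Klein–Gordon equation $$\psi_{tt}-\Delta\psi+W'(\psi)=0\quad\text{on }\mathbb R\times\mathbb R^N,\qquad \psi:\mathbb R\times\mathbb R^N\to\mathbb C, \tag{NKG}$$ understood in the sense of distributions. On the Hilbert space $H^1(\mathbb R^N,\mathbb R)\times\mathbb R$ define the energy and the charge $$E(u,\omega)=\int_{\mathbb R^N}\Big(\tfrac12|\nabla u|^2+\tfrac12\omega^2u^2+W(u)\Big)dx,\qquad C(u,\omega)=-\int_{\mathbb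 R^N}\omega u^2\,dx .$$ Then $W(v)$ is integrable for every $v\in H^1(\mathbb R^N,\mathbb R)$, and $E$ and $C$ are Fréchet differentiable on $H^1(\mathbb R^N,\mathbb R)\times\mathbb R$. Let $u\in H^1(\mathbb R^N,\mathbb R)$ with $u\ge0$ a.e. and $\omega\ge0$ (that is, $(u,\omega)\in Y=H^1(\mathbb R^N,\mathbb R^+)\times\mathbb R^+$), and let $M=\{(v,\sigma)\in H^1(\mathbb R^N,\mathbb R)\times\mathbb R: C(v,\sigma)=C(u,\omega)\}$. 1. The function $\psi_0(t,x)=u(x)e^{-i\omega t}$ is a standing-wave solution of (NKG), i.e. a solution of (NKG) with finite energy ($\psi_0(t,\cdot)\in H^1$, $\partial_t\psi_0(t,\cdot)\in L^2$, $W(\psi_0(t,\cdot))\in L^1$ for every $t$), if and only if $(u,\omega)$ is a critical point of $E$ constrained to $M$, i.e. $\frac{d}{ds}\big|_{s=0}E(\gamma(s))=0$ for every curve $\gamma$ with $\gamma(0)=(u,\omega)$ that is differentiable at $0$ and satisfies $\gamma(s)\in M$ for all small $s$. 2. If $(u,\omega)$ is such a critical point and $C(u,\omega)\neq0$, then a real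 number $\lambda$ satisfies the Lagrange multiplier equation $dE(u,\omega)=\lambda\,dC(u,\omega)$ if and only if $\lambda=-\omega$. -/

import Mathlib

open MeasureTheory Topology

noncomputable section

namespace NKG

/-- The space `ℝ^N` with its Euclidean norm and Lebesgue measure. -/
abbrev Space (N : ℕ) : Type := EuclideanSpace ℝ (Fin N)

/-- `g` is the weak (distributional) `i`-th partial derivative of `u` on `ℝ^N`. -/
structure HasWeakPartial {N : ℕ} {V : Type*} [NormedAddCommGroup V] [NormedSpace ℝ V]
    (i : Fin N) (u g : Space N → V) : Prop where
  locallyIntegrable : LocallyIntegrable u volume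
  locallyIntegrable_deriv : LocallyIntegrable g volume
  integral_eq : ∀ φ : Space N → ℝ, ContDiff ℝ (⊤ : ℕ∞) φ → HasCompactSupport φ →
    ∫ x, fderiv ℝ φ x (EuclideanSpace.single i 1) • u x = -∫ x, φ x • g x

theorem HasWeakPartial.congr {N : ℕ} {V : Type*} [NormedAddCommGroup V] [NormedSpace ℝ V]
    {i : Fin N} {u g u' g' : Space N → V} (h : HasWeakPartial i u g)
    (hu : u' =ᵐ[volume] u) (hg : g' =ᵐ[volume] g) : HasWeakPartial i u' g' where
  locallyIntegrable := h.locallyIntegrable.congr hu.symm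
  locallyIntegrable_deriv := h.locallyIntegrable_deriv.congr hg.symm
  integral_eq φ hφ hc := by
    have h1 : ∫ x, fderiv ℝ φ x (EuclideanSpace.single i 1) • u' x =
        ∫ x, fderiv ℝ φ x (EuclideanSpace.single i 1) • u x :=
      integral_congr_ae (hu.mono fun x hx => by simp only [hx])
    have h2 : ∫ x, φ x • g' x = ∫ x, φ x • g x :=
      integral_congr_ae (hg.mono fun x hx => by simp only [hx])
    rw [h1, h2, h.integral_eq φ hφ hc]

theorem HasWeakPartial.zero {N : ℕ} {V : Type*} [NormedAddCommGroup V] [NormedSpace ℝ V]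
    (i : Fin N) : HasWeakPartial i (fun _ : Space N => (0 : V)) (fun _ => 0) where
  locallyIntegrable := locallyIntegrable_zero
  locallyIntegrable_deriv := locallyIntegrable_zero
  integral_eq φ _ _ := by simp

theorem HasWeakPartial.const_smul {N : ℕ} {V : Type*} [NormedAddCommGroup V] [NormedSpace ℝ V]
    {i : Fin N} {u g : Space N → V} (c : ℝ) (h : HasWeakPartial i u g) :
    HasWeakPartial i (fun x => c • u x) (fun x => c • g x) where
  locallyIntegrable := h.locallyIntegrable.smul c
  locallyIntegrable_deriv := h.locallyIntegrable_deriv.smul c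
  integral_eq φ hφ hc := by
    simp only [smul_comm _ c, integral_smul, h.integral_eq φ hφ hc, smul_neg]

theorem HasWeakPartial.add {N : ℕ} {V : Type*} [NormedAddCommGroup V] [NormedSpace ℝ V]
    {i : Fin N} {u g u' g' : Space N → V} (h : HasWeakPartial i u g)
    (h' : HasWeakPartial i u' g') :
    HasWeakPartial i (fun x => u x + u' x) (fun x => g x + g' x) where
  locallyIntegrable := h.locallyIntegrable.add h'.locallyIntegrable
  locallyIntegrable_deriv := h.locallyIntegrable_deriv.add h'.locallyIntegrable_deriv
  integral_eq φ hφ hc := by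
    have hφ' : Continuous fun x => fderiv ℝ φ x (EuclideanSpace.single i 1) :=
      (hφ.continuous_fderiv (by simp)).clm_apply continuous_const
    have hc' : HasCompactSupport fun x => fderiv ℝ φ x (EuclideanSpace.single i 1) :=
      hc.fderiv_apply ℝ _
    simp only [smul_add]
    rw [integral_add (h.locallyIntegrable.integrable_smul_left_of_hasCompactSupport hφ' hc')
        (h'.locallyIntegrable.integrable_smul_left_of_hasCompactSupport hφ' hc'),
      integral_add
        (h.locallyIntegrable_deriv.integrable_smul_left_of_hasCompactSupport hφ.continuous hc)
        (h'.locallyIntegrable_deriv.integrable_smul_left_of_hasCompactSupport hφ.continuous hc),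
      h.integral_eq φ hφ hc, h'.integral_eq φ hφ hc, neg_add]

/-- The Sobolev space `H¹(ℝ^N, ℝ)`, realized as the space of pairs `(u, ∇u)` in `L² × L²`
whose second entry is the weak gradient of the first, with the norm
`‖u‖² = ‖u‖²_{L²} + ‖∇u‖²_{L²}`. -/
def H1 (N : ℕ) : Submodule ℝ
    (WithLp 2 (Lp ℝ 2 (volume : Measure (Space N)) ×
      Lp (Space N) 2 (volume : Measure (Space N)))) where
  carrier := {p | ∀ i, HasWeakPartial i (fun x => p.fst x) (fun x => p.snd x i)}
  zero_mem' := fun i => (HasWeakPartial.zero i).congr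
    (by simp)
    (by simp)
  add_mem' := fun {p q} hp hq i => ((hp i).add (hq i)).congr
    (by
      filter_upwards [Lp.coeFn_add p.fst q.fst] with x hx
      simpa using hx)
    (by
      filter_upwards [Lp.coeFn_add p.snd q.snd] with x hx
      simpa using congrArg (fun y : Space N => y i) hx)
  smul_mem' := fun c p hp i => ((hp i).const_smul c).congr
    (by
      filter_upwards [Lp.coeFn_smul c p.fst] with x hx
      simpa using hx)
    (by
      filter_upwards [Lp.coeFn_smul c p.snd] with x hx
      simpa using congrArg (fun y : Space N => y i) hx)

/-- The function `ℝ^N → ℝ` underlying an element of `H¹` (an a.e. representative). -/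
def H1.val {N : ℕ} (u : H1 N) : Space N → ℝ := fun x => u.1.fst x

/-- The weak gradient of an element of `H¹`. -/
def H1.grad {N : ℕ} (u : H1 N) : Space N → Space N := fun x => u.1.snd x

/-- The potential `W(z) = F(|z|)` on `ℂ`. -/
def potential (F : ℝ → ℝ) (z : ℂ) : ℝ := F ‖z‖

/-- The nonlinear term `W'(z) = F'(|z|) z / |z|`, with value `0` at `z = 0`. -/
def potentialDeriv (F : ℝ → ℝ) (z : ℂ) : ℂ := ((deriv F ‖z‖ : ℝ) : ℂ) * (z / (‖z‖ : ℂ))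

/-- The function `R` in `W(z) = |z|² / 2 + R(|z|)`. -/
def remainder (F : ℝ → ℝ) (s : ℝ) : ℝ := F s - s ^ 2 / 2

/-- The normalization `W(0) = W'(0) = 0`, `W''(0) = 1`. -/
structure Normalized (F : ℝ → ℝ) : Prop where
  zero : F 0 = 0
  deriv_zero : deriv F 0 = 0
  deriv_deriv_zero : iteratedDeriv 2 F 0 = 1

/-- Subcritical growth: `|R''(s)| ≤ c₁ s^(p-2) + c₂ s^(q-2)` on `[0, ∞)` with
`2 < p ≤ q < 2*`, where `2* = 2N/(N-2)` if `N ≥ 3` and `2* = ∞` if `N = 2`. -/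
def SubcriticalGrowth (N : ℕ) (F : ℝ → ℝ) : Prop :=
  ∃ c₁ c₂ p q : ℝ, 0 < c₁ ∧ 0 < c₂ ∧ 2 < p ∧ p ≤ q ∧
    (2 < N → q < 2 * (N : ℝ) / ((N : ℝ) - 2)) ∧
    ∀ s : ℝ, 0 ≤ s →
      |iteratedDeriv 2 (remainder F) s| ≤ c₁ * s ^ (p - 2) + c₂ * s ^ (q - 2)

/-- The energy `E(u, ω) = ∫ ½|∇u|² + ½ω²u² + W(u)` on `H¹(ℝ^N, ℝ) × ℝ`. -/
def energy {N : ℕ} (F : ℝ → ℝ) (p : H1 N × ℝ) : ℝ :=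
  ∫ x, (1 / 2 * ‖H1.grad p.1 x‖ ^ 2 + 1 / 2 * p.2 ^ 2 * H1.val p.1 x ^ 2
    + potential F (H1.val p.1 x : ℂ))

/-- The charge `C(u, ω) = -∫ ω u²` on `H¹(ℝ^N, ℝ) × ℝ`. -/
def charge {N : ℕ} (p : H1 N × ℝ) : ℝ := -∫ x, p.2 * H1.val p.1 x ^ 2

/-- The set `Y = H¹(ℝ^N, ℝ⁺) × ℝ⁺`, with `ℝ⁺ = [0, ∞)`. -/
def Y (N : ℕ) : Set (H1 N × ℝ) := {p | (∀ᵐ x, 0 ≤ H1.val p.1 x) ∧ 0 ≤ p.2}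

/-- The charge manifold: the level set `{C(u, ω) = c}` in `H¹(ℝ^N, ℝ) × ℝ`. -/
def chargeManifold (N : ℕ) (c : ℝ) : Set (H1 N × ℝ) := {p | charge p = c}

/-- `x` is a critical point of `f` constrained to `M`: it lies on `M`, and `f` has derivative
zero at `x` along every curve in `M` that passes through `x` at time `0` and is differentiable
there. -/
def IsConstrainedCriticalPoint {B : Type*} [NormedAddCommGroup B] [NormedSpace ℝ B]
    (f : B → ℝ) (M : Set B) (x : B) : Prop :=
  x ∈ M ∧ ∀ γ : ℝ → B, γ 0 = x → (∀ᶠ s in 𝓝 (0 : ℝ), γ s ∈ M) → DifferentiableAt ℝ γ 0 →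
    HasDerivAt (fun s => f (γ s)) 0 0

/-- `ψ` solves `ψ_tt - Δψ + W'(ψ) = 0` in the sense of distributions on `ℝ × ℝ^N`. -/
structure IsSolution {N : ℕ} (F : ℝ → ℝ) (ψ : ℝ → Space N → ℂ) : Prop where
  locallyIntegrable : LocallyIntegrable (fun z : ℝ × Space N => ψ z.1 z.2) volume
  locallyIntegrable_potentialDeriv :
    LocallyIntegrable (fun z : ℝ × Space N => potentialDeriv F (ψ z.1 z.2)) volume
  integral_eq_zero : ∀ φ : ℝ × Space N → ℂ, ContDiff ℝ (⊤ : ℕ∞) φ → HasCompactSupport φ →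
    ∫ z : ℝ × Space N,
      (ψ z.1 z.2 * (iteratedDeriv 2 (fun s => φ (s, z.2)) z.1
          - Laplacian.laplacian (fun y => φ (z.1, y)) z.2)
        + potentialDeriv F (ψ z.1 z.2) * φ z) = 0

/-- `ψ` (differentiable in time) has finite energy at every time: `ψ(t, ·) ∈ H¹(ℝ^N, ℂ)`,
`ψ_t(t, ·) ∈ L²(ℝ^N, ℂ)` and `W(ψ(t, ·)) ∈ L¹`. -/
def HasFiniteEnergy {N : ℕ} (F : ℝ → ℝ) (ψ : ℝ → Space N → ℂ) : Prop :=
  ∀ t : ℝ, MemLp (ψ t) 2 volume ∧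
    (∀ i, ∃ g : Space N → ℂ, MemLp g 2 volume ∧ HasWeakPartial i (ψ t) g) ∧
    (∀ x, DifferentiableAt ℝ (fun s => ψ s x) t) ∧
    MemLp (fun x => deriv (fun s => ψ s x) t) 2 volume ∧
    Integrable (fun x => potential F (ψ t x)) volume

/-- The function `ψ(t, x) = u(x) e^{-iωt}`. -/
def standingWave {N : ℕ} (u : H1 N) (ω : ℝ) (t : ℝ) (x : Space N) : ℂ :=
  (H1.val u x : ℂ) * Complex.exp (-Complex.I * ω * t)

end NKG

end

/-!
A standing wave `u(x) e^{-iωt}` turns the nonlinear Klein–Gordon equation into the stationary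
equation `-Δu + W'(u) = ω²u`, and this is exactly the `u`-component of the Lagrange equation
`dE(u, ω) = -ω dC(u, ω)`: the `ω`-component, `ω ∫ u² = λ (-∫ u²)`, is what forces `λ = -ω` as soon
as `u ≠ 0`. The theorem follows once the analysis behind this formal computation is in place.

*Sobolev embedding.* A function in `H¹` belongs to `L^q` for `2 < q < 2*`, with a norm bound
(`H1.exists_integral_rpow_le`). For smooth compactly supported functions this comes from the
Gagliardo–Nirenberg–Sobolev inequality, applied for `N = 2` inductively to powers of the function;
it extends to `H¹` by density of `C_c^∞` and Fatou's lemma.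
Density (`H1.dense_ofTest`) holds because a function orthogonal to `C_c^∞` in `H¹` is, by cutoffs,
orthogonal to the Schwartz space in `H¹`, hence in `L²` to the range of `1 - Δ` on Schwartz
functions, and this operator is onto by the Fourier transform.

*Differentiability.* The growth assumption on `R''` gives `|W''(s)| ≤ A (1 + |s|^(q-2))`, so that
the first-order Taylor remainder of `W` is at most `A (1 + (|u| + |v|)^(q-2)) v²`. For
`v = ε k` with `‖k‖ = 1` and `ε ≤ 1` this is at most `ε²` times a combination of `k²`, `|u|^q` and
`|k|^q`, whose integrals the Sobolev embedding controls; hence the integrated remainder is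
`O(‖v‖²)` and `E` is Fréchet differentiable (`hasFDerivAt_energy`).

*Critical points.* When `u ≠ 0`, every `v` in `H¹` is the velocity in `u` of the curve
`s ↦ (u + s v, ω ‖u‖² / ‖u + s v‖²)` on the charge manifold (norms in `L²`), and being critical
along all these curves is the stationary equation (`IsConstrainedCriticalPoint.euler_lagrange`).
When `u = 0` the stationary equation and `dE = -ω dC` hold trivially. Conversely `dE = -ω dC` makes
`E` stationary along every curve on a level set of `C`.

*Waves.* Tested in `x` at a fixed time, the stationary equation replaces `-Δu + W'(u)` by `ω²u`, and
`∂ₜ² + ω²` annihilates `e^{-iωt}`; by Fubini the stationary equation implies the wave equation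
(`IsWeakStationary.wave`). Test functions `η(t) e^{iωt} χ(x)` with `∫ η ≠ 0` give the converse
(`isWeakStationary_of_wave`).
-/

noncomputable section
namespace NKG

/-! ### Test functions -/

/-- A test function: smooth with compact support. -/
structure IsTest {E V : Type*} [NormedAddCommGroup E] [NormedSpace ℝ E]
    [NormedAddCommGroup V] [NormedSpace ℝ V] (φ : E → V) : Prop where
  contDiff : ContDiff ℝ (⊤ : ℕ∞) φ
  hasCompactSupport : HasCompactSupport φ

/-- The derivative of `φ` in the direction `v`. -/
def dirDeriv {E V : Type*} [NormedAddCommGroup E] [NormedSpace ℝ E]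
    [NormedAddCommGroup V] [NormedSpace ℝ V] (v : E) (φ : E → V) (x : E) : V :=
  fderiv ℝ φ x v

section TestFunctions

variable {E V W : Type*} [NormedAddCommGroup E] [NormedSpace ℝ E]
  [NormedAddCommGroup V] [NormedSpace ℝ V] [NormedAddCommGroup W] [NormedSpace ℝ W]

theorem IsTest.continuous {φ : E → V} (h : IsTest φ) : Continuous φ := h.contDiff.continuous

theorem IsTest.differentiable {φ : E → V} (h : IsTest φ) : Differentiable ℝ φ :=
  h.contDiff.differentiable (by simp)

theorem contDiff_dirDeriv {φ : E → V} (h : ContDiff ℝ (⊤ : ℕ∞) φ) (v : E) :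
    ContDiff ℝ (⊤ : ℕ∞) (dirDeriv v φ) :=
  (h.fderiv_right (by simp)).clm_apply contDiff_const

theorem IsTest.dirDeriv {φ : E → V} (h : IsTest φ) (v : E) : IsTest (dirDeriv v φ) where
  contDiff := contDiff_dirDeriv h.contDiff v
  hasCompactSupport := h.hasCompactSupport.fderiv_apply ℝ v

theorem IsTest.clm_comp {φ : E → V} (h : IsTest φ) (L : V →L[ℝ] W) :
    IsTest (fun x => L (φ x)) where
  contDiff := L.contDiff.comp h.contDiff
  hasCompactSupport := h.hasCompactSupport.comp_left (map_zero L)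

theorem IsTest.add {φ χ : E → V} (h : IsTest φ) (h' : IsTest χ) : IsTest (fun x => φ x + χ x) where
  contDiff := h.contDiff.add h'.contDiff
  hasCompactSupport := h.hasCompactSupport.add h'.hasCompactSupport

theorem IsTest.sum {ι : Type*} [Fintype ι] {φ : ι → E → V} (h : ∀ i, IsTest (φ i)) :
    IsTest (fun x => ∑ i, φ i x) where
  contDiff := ContDiff.sum fun i _ => (h i).contDiff
  hasCompactSupport := by
    have : ∀ s : Finset ι, HasCompactSupport fun x => ∑ i ∈ s, φ i x := by
      intro s
      induction s using Finset.cons_induction with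
      | empty => simp only [Finset.sum_empty]; exact HasCompactSupport.zero
      | cons a s ha ih =>
        simp only [Finset.sum_cons]
        exact (h a).hasCompactSupport.add ih
    exact this _

theorem IsTest.smul_left {ρ : E → ℝ} {φ : E → V} (hρ : ContDiff ℝ (⊤ : ℕ∞) ρ) (h : IsTest φ) :
    IsTest (fun x => ρ x • φ x) where
  contDiff := hρ.smul h.contDiff
  hasCompactSupport := h.hasCompactSupport.smul_left

theorem IsTest.memLp {φ : E → V} (h : IsTest φ) [MeasurableSpace E] [BorelSpace E]
    {μ : Measure E} [IsFiniteMeasureOnCompacts μ] (p : ENNReal) :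
    MemLp φ p μ :=
  h.continuous.memLp_of_hasCompactSupport h.hasCompactSupport

theorem IsTest.integrable_smul {φ : E → ℝ} (h : IsTest φ) [MeasurableSpace E] [BorelSpace E]
    {μ : Measure E} {f : E → V}
    (hf : LocallyIntegrable f μ) : Integrable (fun x => φ x • f x) μ :=
  hf.integrable_smul_left_of_hasCompactSupport h.continuous h.hasCompactSupport

theorem IsTest.integrable_mul {φ : E → ℂ} (h : IsTest φ) [MeasurableSpace E] [BorelSpace E]
    {μ : Measure E} {f : E → ℂ}
    (hf : LocallyIntegrable f μ) : Integrable (fun x => f x * φ x) μ := by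
  refine (hf.integrable_smul_left_of_hasCompactSupport h.continuous h.hasCompactSupport).congr ?_
  filter_upwards with x
  simp [mul_comm]

end TestFunctions

section Laplace

variable {N : ℕ} {V : Type*} [NormedAddCommGroup V] [NormedSpace ℝ V]

/-- The `i`-th standard basis vector of `ℝ^N`. -/
abbrev stdVec (N : ℕ) (i : Fin N) : Space N := EuclideanSpace.single i 1

theorem laplacian_eq_sum_dirDeriv {φ : Space N → V} (h : ContDiff ℝ 2 φ) (x : Space N) :
    Laplacian.laplacian φ x = ∑ i, dirDeriv (stdVec N i) (dirDeriv (stdVec N i) φ) x := by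
  rw [InnerProductSpace.laplacian_eq_iteratedFDeriv_orthonormalBasis φ
    (EuclideanSpace.basisFun (Fin N) ℝ)]
  refine Finset.sum_congr rfl fun i _ => ?_
  have h1 : DifferentiableAt ℝ (fderiv ℝ φ) x :=
    ((h.fderiv_right (m := 1) (by norm_num)).differentiable (by norm_num)) x
  unfold dirDeriv
  rw [iteratedFDeriv_two_apply, fderiv_clm_apply h1 (differentiableAt_const _)]
  simp

theorem IsTest.laplacian {φ : Space N → V} (h : IsTest φ) :
    IsTest (fun x => Laplacian.laplacian φ x) := by
  have : (fun x => Laplacian.laplacian φ x) =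
      fun x => ∑ i, NKG.dirDeriv (stdVec N i) (NKG.dirDeriv (stdVec N i) φ) x := by
    ext x; exact laplacian_eq_sum_dirDeriv (h.contDiff.of_le (by norm_cast)) x
  rw [this]
  exact IsTest.sum fun i => (h.dirDeriv _).dirDeriv _

theorem gradient_apply (φ : Space N → ℝ) (x : Space N) (i : Fin N) :
    gradient φ x i = dirDeriv (stdVec N i) φ x := by
  have : gradient φ x i = inner ℝ (gradient φ x) (stdVec N i) := by
    rw [EuclideanSpace.inner_single_right]; simp
  rw [this, gradient, InnerProductSpace.toDual_symm_apply, dirDeriv]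

theorem norm_gradient (φ : Space N → ℝ) (x : Space N) : ‖gradient φ x‖ = ‖fderiv ℝ φ x‖ := by
  simp [gradient]

theorem inner_gradient (φ : Space N → ℝ) (x y : Space N) :
    inner ℝ (gradient φ x) y = fderiv ℝ φ x y := by
  simp [gradient]

theorem IsTest.gradient {φ : Space N → ℝ} (h : IsTest φ) : IsTest (gradient φ) where
  contDiff := (InnerProductSpace.toDual ℝ (Space N)).symm.contDiff.comp
    (h.contDiff.fderiv_right (by simp))
  hasCompactSupport := (h.hasCompactSupport.fderiv ℝ).comp_left
    (g := (InnerProductSpace.toDual ℝ (Space N)).symm) (map_zero _)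

/-- Integration by parts: a test function has its classical partial derivatives as weak ones. -/
theorem IsTest.hasWeakPartial {φ : Space N → ℝ} (h : IsTest φ) (i : Fin N) :
    HasWeakPartial i φ (NKG.dirDeriv (stdVec N i) φ) where
  locallyIntegrable := h.continuous.locallyIntegrable
  locallyIntegrable_deriv := (h.dirDeriv _).continuous.locallyIntegrable
  integral_eq χ hχ hc := by
    have hχ' : IsTest χ := ⟨hχ, hc⟩
    rw [eq_neg_iff_add_eq_zero, add_comm, ← eq_neg_iff_add_eq_zero]
    exact integral_smul_fderiv_eq_neg_fderiv_smul_of_integrable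
      ((hχ'.dirDeriv _).integrable_smul h.continuous.locallyIntegrable)
      (hχ'.integrable_smul (h.dirDeriv _).continuous.locallyIntegrable)
      (hχ'.integrable_smul h.continuous.locallyIntegrable)
      (fun x _ => hχ'.differentiable x) (fun x _ => h.differentiable x)

end Laplace

/-! ### The Hilbert space `H¹` -/

section H1

variable {N : ℕ}

theorem H1.memLp_val (u : H1 N) : MemLp (H1.val u) 2 volume := Lp.memLp u.1.fst

theorem H1.memLp_grad (u : H1 N) : MemLp (H1.grad u) 2 volume := Lp.memLp u.1.snd

theorem H1.hasWeakPartial (u : H1 N) (i : Fin N) :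
    HasWeakPartial i (H1.val u) (fun x => H1.grad u x i) := u.2 i

theorem H1.val_add (u v : H1 N) : H1.val (u + v) =ᵐ[volume] fun x => H1.val u x + H1.val v x :=
  Lp.coeFn_add u.1.fst v.1.fst

theorem H1.val_smul (c : ℝ) (u : H1 N) : H1.val (c • u) =ᵐ[volume] fun x => c * H1.val u x :=
  Lp.coeFn_smul c u.1.fst

theorem H1.grad_add (u v : H1 N) :
    H1.grad (u + v) =ᵐ[volume] fun x => H1.grad u x + H1.grad v x :=
  Lp.coeFn_add u.1.snd v.1.snd

theorem H1.grad_smul (c : ℝ) (u : H1 N) : H1.grad (c • u) =ᵐ[volume] fun x => c • H1.grad u x :=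
  Lp.coeFn_smul c u.1.snd

theorem H1.val_zero : H1.val (0 : H1 N) =ᵐ[volume] fun _ => 0 :=
  Lp.coeFn_zero ℝ 2 volume

/-- The inclusion of `H¹` into `L²`. -/
def H1.toL2 (N : ℕ) : H1 N →L[ℝ] Lp ℝ 2 (volume : Measure (Space N)) :=
  (WithLp.fstL 2 ℝ _ _).comp (H1 N).subtypeL

/-- The weak gradient as an operator from `H¹` to `L²`. -/
def H1.gradL2 (N : ℕ) : H1 N →L[ℝ] Lp (Space N) 2 (volume : Measure (Space N)) :=
  (WithLp.sndL 2 ℝ _ _).comp (H1 N).subtypeL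

theorem H1.inner_toL2 (u v : H1 N) :
    inner ℝ (H1.toL2 N u) (H1.toL2 N v) = ∫ x, H1.val u x * H1.val v x := by
  rw [L2.inner_def]
  exact integral_congr_ae (by filter_upwards with x using mul_comm _ _)

theorem H1.inner_gradL2 (u v : H1 N) :
    inner ℝ (H1.gradL2 N u) (H1.gradL2 N v) = ∫ x, inner ℝ (H1.grad u x) (H1.grad v x) :=
  L2.inner_def _ _

theorem H1.inner_def (u v : H1 N) : inner ℝ u v =
    inner ℝ (H1.toL2 N u) (H1.toL2 N v) + inner ℝ (H1.gradL2 N u) (H1.gradL2 N v) := by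
  exact WithLp.prod_inner_apply (u : WithLp 2 (Lp ℝ 2 (volume : Measure (Space N)) ×
    Lp (Space N) 2 (volume : Measure (Space N)))) v

theorem H1.norm_sq_eq (u : H1 N) : ‖u‖ ^ 2 = ‖H1.toL2 N u‖ ^ 2 + ‖H1.gradL2 N u‖ ^ 2 := by
  exact WithLp.prod_norm_sq_eq_of_L2 (u : WithLp 2 (Lp ℝ 2 (volume : Measure (Space N)) ×
    Lp (Space N) 2 (volume : Measure (Space N))))

theorem H1.norm_toL2_le (u : H1 N) : ‖H1.toL2 N u‖ ≤ ‖u‖ := by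
  have := H1.norm_sq_eq u
  exact abs_le_of_sq_le_sq' (by nlinarith [sq_nonneg ‖H1.gradL2 N u‖]) (norm_nonneg _) |>.2

theorem H1.norm_gradL2_le (u : H1 N) : ‖H1.gradL2 N u‖ ≤ ‖u‖ := by
  have := H1.norm_sq_eq u
  exact abs_le_of_sq_le_sq' (by nlinarith [sq_nonneg ‖H1.toL2 N u‖]) (norm_nonneg _) |>.2

theorem H1.norm_toL2_sq (u : H1 N) : ‖H1.toL2 N u‖ ^ 2 = ∫ x, H1.val u x ^ 2 := by
  rw [← real_inner_self_eq_norm_sq, H1.inner_toL2]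
  simp only [sq]

theorem H1.norm_gradL2_sq (u : H1 N) : ‖H1.gradL2 N u‖ ^ 2 = ∫ x, ‖H1.grad u x‖ ^ 2 := by
  rw [← real_inner_self_eq_norm_sq, H1.inner_gradL2]
  simp only [real_inner_self_eq_norm_sq]

theorem H1.integral_val_sq_le (u : H1 N) : ∫ x, H1.val u x ^ 2 ≤ ‖u‖ ^ 2 := by
  rw [← H1.norm_toL2_sq]
  have := H1.norm_toL2_le u
  gcongr

theorem H1.integrable_val_sq (u : H1 N) : Integrable (fun x => H1.val u x ^ 2) :=
  (H1.memLp_val u).integrable_sq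

/-- A test function as an element of `H¹`. -/
def H1.ofTest {φ : Space N → ℝ} (h : IsTest φ) : H1 N :=
  ⟨WithLp.toLp 2 ((h.memLp 2).toLp φ, (h.gradient.memLp 2).toLp (gradient φ)), fun i =>
    (h.hasWeakPartial i).congr (MemLp.coeFn_toLp (h.memLp 2)) (by
      filter_upwards [MemLp.coeFn_toLp (μ := volume) (h.gradient.memLp 2)] with x hx
      rw [← gradient_apply, ← hx]
      rfl)⟩

theorem H1.val_ofTest {φ : Space N → ℝ} (h : IsTest φ) : H1.val (H1.ofTest h) =ᵐ[volume] φ := by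
  exact MemLp.coeFn_toLp (μ := volume) (h.memLp 2)

theorem H1.grad_ofTest {φ : Space N → ℝ} (h : IsTest φ) :
    H1.grad (H1.ofTest h) =ᵐ[volume] gradient φ := by
  exact MemLp.coeFn_toLp (μ := volume) (h.gradient.memLp 2)

theorem H1.inner_toL2_ofTest (u : H1 N) {φ : Space N → ℝ} (h : IsTest φ) :
    inner ℝ (H1.toL2 N u) (H1.toL2 N (H1.ofTest h)) = ∫ x, H1.val u x * φ x := by
  rw [H1.inner_toL2]
  refine integral_congr_ae ?_
  filter_upwards [H1.val_ofTest h] with x hx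
  rw [hx]

/-- Pairing a weak gradient with the gradient of a test function moves both derivatives onto
the test function. -/
theorem H1.inner_gradL2_ofTest (u : H1 N) {φ : Space N → ℝ} (h : IsTest φ) :
    inner ℝ (H1.gradL2 N u) (H1.gradL2 N (H1.ofTest h)) =
      -∫ x, H1.val u x * Laplacian.laplacian φ x := by
  have e1 : inner ℝ (H1.gradL2 N u) (H1.gradL2 N (H1.ofTest h)) =
      ∫ x, ∑ i, dirDeriv (stdVec N i) φ x • H1.grad u x i := by
    rw [H1.inner_gradL2]
    refine integral_congr_ae ?_
    filter_upwards [H1.grad_ofTest h] with x hx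
    rw [hx, PiLp.inner_apply]
    refine Finset.sum_congr rfl fun i _ => ?_
    rw [gradient_apply]
    simp
  have e2 : ∫ x, H1.val u x * Laplacian.laplacian φ x =
      ∫ x, ∑ i, dirDeriv (stdVec N i) (dirDeriv (stdVec N i) φ) x • H1.val u x := by
    congr 1
    ext x
    rw [laplacian_eq_sum_dirDeriv (h.contDiff.of_le (by norm_cast)), Finset.mul_sum]
    exact Finset.sum_congr rfl fun i _ => mul_comm _ _
  rw [e1, e2, integral_finsetSum, integral_finsetSum, ← Finset.sum_neg_distrib]
  · refine Finset.sum_congr rfl fun i _ => ?_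
    have := (H1.hasWeakPartial u i).integral_eq _ (h.dirDeriv (stdVec N i)).contDiff
      (h.dirDeriv (stdVec N i)).hasCompactSupport
    rw [← neg_eq_iff_eq_neg] at this
    exact this.symm
  · exact fun i _ => ((h.dirDeriv _).dirDeriv _).integrable_smul
      (H1.hasWeakPartial u i).locallyIntegrable
  · exact fun i _ => (h.dirDeriv _).integrable_smul (H1.hasWeakPartial u i).locallyIntegrable_deriv

end H1
end NKG
end

noncomputable section
namespace NKG

/-! ### Solving `φ - Δφ = g` in the Schwartz space -/

section Schwartz
open scoped SchwartzMap LineDeriv Laplacian Real FourierTransform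

theorem hasTemperateGrowth_inv_one_add_norm_sq {N : ℕ} :
    (fun x : Space N => (1 + (2 * π) ^ 2 * ‖x‖ ^ 2)⁻¹).HasTemperateGrowth := by
  have h1 := Function.hasTemperateGrowth_one_add_norm_sq_rpow (Space N) (-1)
  have h2 := ContinuousLinearMap.hasTemperateGrowth ((2 * π) • ContinuousLinearMap.id ℝ (Space N))
  have := h1.comp h2
  have e : (fun x : Space N => (1 + (2 * π) ^ 2 * ‖x‖ ^ 2)⁻¹) =
      (fun x : Space N => (1 + ‖x‖ ^ 2) ^ (-1 : ℝ)) ∘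
        ⇑((2 * π) • ContinuousLinearMap.id ℝ (Space N)) := by
    ext x
    simp only [Function.comp_apply, Real.rpow_neg_one, smul_apply,
      ContinuousLinearMap.id_apply, norm_smul, mul_pow, Real.norm_eq_abs, sq_abs]
  rw [e]
  exact this

/-- The operator `1 - Δ` is onto on the Schwartz space: on the Fourier side it is multiplication
by `1 + 4π²|ξ|²`, whose reciprocal is again an admissible multiplier. -/
theorem exists_sub_laplacian_eq {N : ℕ} (g : 𝓢(Space N, ℂ)) :
    ∃ φ : 𝓢(Space N, ℂ), φ - Δ φ = g := by
  have hm := @hasTemperateGrowth_inv_one_add_norm_sq N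
  have hs : ((fun x : Space N => ‖x‖) ^ 2).HasTemperateGrowth := by
    change (fun x : Space N => ‖x‖ ^ 2).HasTemperateGrowth
    fun_prop
  refine ⟨SchwartzMap.fourierMultiplierCLM ℂ
    (fun x : Space N => (1 + (2 * π) ^ 2 * ‖x‖ ^ 2)⁻¹) g, ?_⟩
  have e := SchwartzMap.laplacian_eq_fourierMultiplierCLM (SchwartzMap.fourierMultiplierCLM ℂ
    (fun x : Space N => (1 + (2 * π) ^ 2 * ‖x‖ ^ 2)⁻¹) g)
  have e2 := SchwartzMap.fourierMultiplierCLM_fourierMultiplierCLM_apply hs hm g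
  rw [e]
  erw [e2]
  rw [SchwartzMap.fourierMultiplierCLM_apply, SchwartzMap.fourierMultiplierCLM_apply,
    ← FourierTransform.fourierInv_smul]
  rw [← FourierTransform.fourierInvCLM_apply (R := ℝ),
    ← FourierTransform.fourierInvCLM_apply (R := ℝ), ← map_sub]
  rw [FourierTransform.fourierInvCLM_apply]
  refine Eq.trans ?_ (show 𝓕⁻ (𝓕 g) = g from FourierTransform.fourierInv_fourier_eq g)
  congr 1
  ext x
  rw [sub_apply, smul_apply, SchwartzMap.smulLeftCLM_apply_apply hm,
    SchwartzMap.smulLeftCLM_apply_apply (hs.mul hm), smul_smul, ← sub_smul]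
  have : (1 + (2 * π) ^ 2 * ‖x‖ ^ 2) ≠ 0 := by positivity
  have e : ((1 + (2 * π) ^ 2 * ‖x‖ ^ 2)⁻¹ - -(2 * π) ^ 2 * (((fun x : Space N => ‖x‖) ^ 2 :
    Space N → ℝ) * fun x : Space N => (1 + (2 * π) ^ 2 * ‖x‖ ^ 2)⁻¹ : Space N → ℝ) x) = 1 := by
    simp only [Pi.mul_apply, Pi.pow_apply]
    field_simp
    ring
  rw [e, one_smul]
end Schwartz

/-! ### Density of test functions in `H¹` -/

section Density
variable {N : ℕ}

theorem integrable_clm_apply {L : Space N → Space N →L[ℝ] ℝ} {b : Space N → Space N}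
    (hL : MemLp L 2 volume) (hb : MemLp b 2 volume) : Integrable fun x => L x (b x) := by
  refine (hL.norm.integrable_mul hb.norm).mono ?_ ?_
  · exact (ContinuousLinearMap.apply ℝ ℝ).flip.aestronglyMeasurable_comp₂
      hL.aestronglyMeasurable hb.aestronglyMeasurable
  · filter_upwards with x
    simpa using (L x).le_opNorm (b x)

/-- A first-order identity which holds against all test functions holds against every smooth
function which is square integrable together with its derivative: multiply it by the cutoffs
`χ(x / (n + 1))`, whose derivatives are `O(1 / n)`. -/
theorem integral_eq_zero_of_forall_isTest {a : Space N → ℝ} {b : Space N → Space N}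
    (ha : MemLp a 2 volume) (hb : MemLp b 2 volume)
    (h : ∀ φ : Space N → ℝ, IsTest φ → ∫ x, (φ x * a x + fderiv ℝ φ x (b x)) = 0)
    {ρ : Space N → ℝ} (hρ : ContDiff ℝ (⊤ : ℕ∞) ρ) (h0 : MemLp ρ 2 volume)
    (h1 : MemLp (fderiv ℝ ρ) 2 volume) :
    ∫ x, (ρ x * a x + fderiv ℝ ρ x (b x)) = 0 := by
  let χ : ContDiffBump (0 : Space N) := ⟨1, 2, one_pos, one_lt_two⟩
  have hχ : IsTest (χ : Space N → ℝ) := ⟨χ.contDiff, χ.hasCompactSupport⟩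
  obtain ⟨C, hC⟩ : ∃ C, ∀ x, ‖fderiv ℝ χ x‖ ≤ C :=
    (hχ.hasCompactSupport.fderiv ℝ).exists_bound_of_continuous
      (hχ.contDiff.continuous_fderiv (by simp))
  let c : ℕ → ℝ := fun n => 1 / ((n : ℝ) + 1)
  have hc0 : ∀ n, 0 < c n := fun n => by positivity
  have hc1 : ∀ n, c n ≤ 1 := fun n => by
    simp only [c]
    rw [div_le_one (by positivity)]
    linarith [(n.cast_nonneg : (0 : ℝ) ≤ n)]
  have hcl : Filter.Tendsto c Filter.atTop (𝓝 0) := tendsto_one_div_add_atTop_nhds_zero_nat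
  have hχn : ∀ n, IsTest fun x => χ (c n • x) := fun n =>
    ⟨hχ.contDiff.comp (contDiff_const_smul _), hχ.hasCompactSupport.comp_smul (hc0 n).ne'⟩
  have hD : ∀ n x, fderiv ℝ (fun x => χ (c n • x) * ρ x) x (b x) =
      χ (c n • x) * fderiv ℝ ρ x (b x) + c n * (fderiv ℝ χ (c n • x) (b x) * ρ x) := by
    intro n x
    rw [fderiv_fun_mul ((hχn n).differentiable x) (hρ.differentiable (by simp) x)]
    rw [fderiv_comp_smul (f := χ)]
    simp only [add_apply, smul_apply, smul_eq_mul]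
    ring
  have hFn : ∀ n, ∫ x, (χ (c n • x) * (ρ x * a x + fderiv ℝ ρ x (b x))
      + c n * (fderiv ℝ χ (c n • x) (b x) * ρ x)) = 0 := by
    intro n
    rw [← h (fun x => χ (c n • x) * ρ x)
      ⟨(hχn n).contDiff.mul hρ, (hχn n).hasCompactSupport.mul_right⟩]
    congr 1
    ext x
    rw [hD]
    ring
  have hint1 : Integrable (fun x => ρ x * a x) := h0.integrable_mul ha
  have hint2 : Integrable (fun x => fderiv ℝ ρ x (b x)) := integrable_clm_apply h1 hb
  have hint3 : Integrable (fun x => ‖b x‖ * ‖ρ x‖) := hb.norm.integrable_mul h0.norm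
  have hmeas3 : ∀ n, AEStronglyMeasurable (fun x => fderiv ℝ χ (c n • x) (b x)) volume := by
    intro n
    refine (ContinuousLinearMap.apply ℝ ℝ).flip.aestronglyMeasurable_comp₂
        (Continuous.aestronglyMeasurable ?_) hb.aestronglyMeasurable
    exact (hχ.contDiff.continuous_fderiv (by simp)).comp (continuous_const_smul _)
  have key := tendsto_integral_of_dominated_convergence (μ := volume)
    (F := fun n x => χ (c n • x) * (ρ x * a x + fderiv ℝ ρ x (b x))
      + c n * (fderiv ℝ χ (c n • x) (b x) * ρ x))
    (f := fun x => ρ x * a x + fderiv ℝ ρ x (b x))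
    (fun x => ‖ρ x * a x + fderiv ℝ ρ x (b x)‖ + C * (‖b x‖ * ‖ρ x‖)) ?_ ?_ ?_ ?_
  · simp only [hFn] at key
    exact (tendsto_nhds_unique key tendsto_const_nhds)
  · intro n
    exact ((hχn n).continuous.aestronglyMeasurable.mul (hint1.add hint2).aestronglyMeasurable).add
      (((hmeas3 n).mul h0.aestronglyMeasurable).const_mul _)
  · exact (hint1.add hint2).norm.add (hint3.const_mul C)
  · intro n
    filter_upwards with x
    refine (norm_add_le _ _).trans (add_le_add ?_ ?_)
    · rw [norm_mul]
      have : ‖χ (c n • x)‖ ≤ 1 := by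
        rw [Real.norm_of_nonneg χ.nonneg]; exact χ.le_one
      nlinarith [norm_nonneg (ρ x * a x + fderiv ℝ ρ x (b x))]
    · rw [norm_mul, norm_mul, Real.norm_of_nonneg (hc0 n).le]
      have h3 : ‖fderiv ℝ χ (c n • x) (b x)‖ ≤ C * ‖b x‖ :=
        ((fderiv ℝ χ (c n • x)).le_opNorm (b x)).trans
          (mul_le_mul_of_nonneg_right (hC _) (norm_nonneg _))
      calc c n * (‖fderiv ℝ χ (c n • x) (b x)‖ * ‖ρ x‖)
          ≤ 1 * ((C * ‖b x‖) * ‖ρ x‖) := by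
            have := hc1 n
            gcongr
        _ = _ := by ring
  · filter_upwards with x
    have t0 : Filter.Tendsto (fun n => c n • x) Filter.atTop (𝓝 0) := by
      simpa using hcl.smul_const x
    have t1 : Filter.Tendsto (fun n => χ (c n • x)) Filter.atTop (𝓝 1) := by
      have := (hχ.continuous.tendsto 0).comp t0
      rwa [χ.one_of_mem_closedBall (Metric.mem_closedBall_self χ.rIn_pos.le)] at this
    have t2 : Filter.Tendsto (fun n => fderiv ℝ χ (c n • x) (b x) * ρ x) Filter.atTop
        (𝓝 (fderiv ℝ χ 0 (b x) * ρ x)) := by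
      have : Filter.Tendsto (fun n => fderiv ℝ χ (c n • x)) Filter.atTop (𝓝 (fderiv ℝ χ 0)) :=
        ((hχ.contDiff.continuous_fderiv (by simp)).tendsto (0 : Space N)).comp t0
      exact (((ContinuousLinearMap.apply ℝ ℝ (b x)).continuous.tendsto _).comp this).mul_const _
    have := (t1.mul_const (ρ x * a x + fderiv ℝ ρ x (b x))).add (hcl.mul t2)
    simpa using this

/-- Membership in `H¹` as a family of orthogonality relations in `L² × L²`, which shows that `H¹`
is closed. -/
theorem H1.mem_iff (p : WithLp 2 (Lp ℝ 2 (volume : Measure (Space N)) ×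
      Lp (Space N) 2 (volume : Measure (Space N)))) :
    p ∈ H1 N ↔ ∀ (i : Fin N) (φ : Space N → ℝ) (h : IsTest φ),
      inner ℝ (((h.dirDeriv (stdVec N i)).memLp 2).toLp _) p.fst + inner ℝ
        (((h.clm_comp (ContinuousLinearMap.toSpanSingleton ℝ (stdVec N i))).memLp 2).toLp _)
          p.snd = 0 := by
  have key : ∀ (i : Fin N) (φ : Space N → ℝ) (h : IsTest φ),
      inner ℝ (((h.dirDeriv (stdVec N i)).memLp 2).toLp _) p.fst + inner ℝ
        (((h.clm_comp (ContinuousLinearMap.toSpanSingleton ℝ (stdVec N i))).memLp 2).toLp _)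
          p.snd = (∫ x, fderiv ℝ φ x (stdVec N i) • p.fst x) + ∫ x, φ x • p.snd x i := by
    intro i φ h
    rw [L2.inner_def, L2.inner_def]
    congr 1
    · refine integral_congr_ae ?_
      filter_upwards [MemLp.coeFn_toLp (μ := volume) ((h.dirDeriv (stdVec N i)).memLp 2)] with x hx
      rw [hx]
      exact mul_comm _ _
    · refine integral_congr_ae ?_
      filter_upwards [MemLp.coeFn_toLp (μ := volume)
        ((h.clm_comp (ContinuousLinearMap.toSpanSingleton ℝ (stdVec N i))).memLp 2)] with x hx
      rw [hx, ContinuousLinearMap.toSpanSingleton_apply, real_inner_smul_left,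
        EuclideanSpace.inner_single_left]
      simp
  constructor
  · intro hp i φ h
    rw [key i φ h, (hp i).integral_eq φ h.contDiff h.hasCompactSupport, neg_add_cancel]
  · intro hp i
    refine ⟨(Lp.memLp p.fst).locallyIntegrable one_le_two,
      ((Lp.memLp p.snd).eval_piLp i).locallyIntegrable one_le_two, fun φ hφ hc => ?_⟩
    rw [eq_neg_iff_add_eq_zero, ← hp i φ ⟨hφ, hc⟩, key i φ ⟨hφ, hc⟩]

instance H1.instCompleteSpace : CompleteSpace (H1 N) := by
  suffices h : IsClosed (H1 N : Set (WithLp 2 (Lp ℝ 2 (volume : Measure (Space N)) ×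
      Lp (Space N) 2 (volume : Measure (Space N))))) from h.completeSpace_coe
  have : (H1 N : Set (WithLp 2 (Lp ℝ 2 (volume : Measure (Space N)) ×
      Lp (Space N) 2 (volume : Measure (Space N))))) =
      ⋂ (i : Fin N) (φ : Space N → ℝ) (h : IsTest φ), {p |
      inner ℝ (((h.dirDeriv (stdVec N i)).memLp 2).toLp _) p.fst + inner ℝ
        (((h.clm_comp (ContinuousLinearMap.toSpanSingleton ℝ (stdVec N i))).memLp 2).toLp _)
          p.snd = 0} := by
    ext p
    simp only [SetLike.mem_coe, H1.mem_iff, Set.mem_iInter, Set.mem_ofPred_eq]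
  rw [this]
  refine isClosed_iInter fun i => isClosed_iInter fun φ => isClosed_iInter fun h =>
    isClosed_eq ?_ continuous_const
  exact (continuous_const.inner (WithLp.fstL 2 ℝ _ _).continuous).add
    (continuous_const.inner (WithLp.sndL 2 ℝ _ _).continuous)

theorem H1.ext {u v : H1 N} (h : H1.val u =ᵐ[volume] H1.val v)
    (h' : H1.grad u =ᵐ[volume] H1.grad v) : u = v := by
  refine Subtype.ext (WithLp.ofLp_injective 2 (Prod.ext ?_ ?_))
  · exact Lp.ext h
  · exact Lp.ext h'

theorem H1.memLp_grad_apply (u : H1 N) (i : Fin N) :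
    MemLp (fun x => H1.grad u x i) 2 volume :=
  (H1.memLp_grad u).eval_piLp i

open scoped SchwartzMap LineDeriv Laplacian in
theorem fderiv_re_schwartz (φ : 𝓢(Space N, ℂ)) (x : Space N) :
    fderiv ℝ (fun y => (φ y).re) x = Complex.reCLM.comp (fderiv ℝ φ x) :=
  (Complex.reCLM.hasFDerivAt.comp x φ.differentiableAt.hasFDerivAt).fderiv

/-- `integral_eq_zero_of_forall_isTest` for the real part of a Schwartz function. -/
theorem integral_re_schwartz_eq_zero {a : Space N → ℝ} {b : Space N → Space N}
    (ha : MemLp a 2 volume) (hb : MemLp b 2 volume)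
    (h : ∀ φ : Space N → ℝ, IsTest φ → ∫ x, (φ x * a x + fderiv ℝ φ x (b x)) = 0)
    (φ : SchwartzMap (Space N) ℂ) :
    ∫ x, ((φ x).re * a x + (fderiv ℝ φ x (b x)).re) = 0 := by
  have e : ∀ x, (fderiv ℝ φ x (b x)).re = fderiv ℝ (fun y => (φ y).re) x (b x) := fun x => by
    rw [fderiv_re_schwartz]; rfl
  simp only [e]
  refine integral_eq_zero_of_forall_isTest ha hb h ?_ ?_ ?_
  · exact Complex.reCLM.contDiff.comp φ.smooth'
  · exact (φ.memLp 2).re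
  · have : MemLp (fderiv ℝ φ) 2 volume := by
      have := (SchwartzMap.fderivCLM ℝ (Space N) ℂ φ).memLp 2 volume
      exact this
    have e2 : fderiv ℝ (fun y => (φ y).re) = fun x => Complex.reCLM.comp (fderiv ℝ φ x) :=
      funext fun x => fderiv_re_schwartz φ x
    rw [e2]
    exact (ContinuousLinearMap.compL ℝ (Space N) ℂ ℝ Complex.reCLM).comp_memLp' this

open scoped SchwartzMap LineDeriv Laplacian in
/-- An element of `H¹` orthogonal to all test functions solves `w - Δw = 0` in the sense of
distributions; as `1 - Δ` is onto on the Schwartz space, such a `w` vanishes. -/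
theorem H1.eq_zero_of_forall_inner_ofTest {w : H1 N}
    (hw : ∀ (φ : Space N → ℝ) (h : IsTest φ), inner ℝ w (H1.ofTest h) = 0) : w = 0 := by
  have hloc : LocallyIntegrable (H1.val w) volume :=
    (H1.memLp_val w).locallyIntegrable one_le_two
  have hgradtest : ∀ φ : Space N → ℝ, IsTest φ →
      Integrable (fun x => fderiv ℝ φ x (H1.grad w x)) := by
    intro φ h
    exact integrable_clm_apply ((h.contDiff.continuous_fderiv
      (by simp)).memLp_of_hasCompactSupport (h.hasCompactSupport.fderiv ℝ)) (H1.memLp_grad w)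
  have hbase : ∀ φ : Space N → ℝ, IsTest φ →
      ∫ x, (φ x * H1.val w x + fderiv ℝ φ x (H1.grad w x)) = 0 := by
    intro φ h
    have e := hw φ h
    rw [H1.inner_def, H1.inner_toL2_ofTest, H1.inner_gradL2] at e
    have hi : Integrable fun x => φ x * H1.val w x := h.integrable_smul hloc
    rw [← e, integral_add hi (hgradtest φ h)]
    congr 1
    · exact integral_congr_ae (by filter_upwards with x using mul_comm _ _)
    · refine integral_congr_ae ?_
      filter_upwards [H1.grad_ofTest h] with x hx
      rw [hx, real_inner_comm, inner_gradient]
  have hgrad : ∀ i, ∀ φ : Space N → ℝ, IsTest φ →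
      ∫ x, (φ x * H1.grad w x i + fderiv ℝ φ x (H1.val w x • stdVec N i)) = 0 := by
    intro i φ h
    have h1 := (H1.hasWeakPartial w i).integral_eq φ h.contDiff h.hasCompactSupport
    have j1 : Integrable fun x => φ x * H1.grad w x i :=
      h.integrable_smul (H1.hasWeakPartial w i).locallyIntegrable_deriv
    have j2 : Integrable fun x => fderiv ℝ φ x (stdVec N i) * H1.val w x :=
      (h.dirDeriv _).integrable_smul hloc
    simp only [map_smul, smul_eq_mul, mul_comm (H1.val w _)]
    rw [integral_add j1 j2, add_comm]
    exact eq_neg_iff_add_eq_zero.1 h1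
  have hvi : ∀ i, MemLp (fun x => H1.val w x • stdVec N i) 2 volume := fun i =>
    (ContinuousLinearMap.toSpanSingleton ℝ (stdVec N i)).comp_memLp' (H1.memLp_val w)
  -- pairing with `(1 - Δ) φ` for Schwartz `φ`
  have hS : ∀ φ : 𝓢(Space N, ℂ), ∫ x, ((φ - Δ φ) x).re * H1.val w x = 0 := by
    intro φ
    have k0 := integral_re_schwartz_eq_zero (H1.memLp_val w) (H1.memLp_grad w) hbase φ
    let D : Fin N → 𝓢(Space N, ℂ) := fun i => ∂_{stdVec N i} φ
    let DD : Fin N → 𝓢(Space N, ℂ) := fun i => ∂_{stdVec N i} (D i)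
    have hD : ∀ i x, fderiv ℝ φ x (stdVec N i) = D i x := fun i x => rfl
    have hDD : ∀ i x, fderiv ℝ (D i) x (stdVec N i) = DD i x := fun i x => rfl
    have k1 := fun i => integral_re_schwartz_eq_zero (H1.memLp_grad_apply w i) (hvi i) (hgrad i)
      (D i)
    have l : ∀ ψ : 𝓢(Space N, ℂ), MemLp (fun x => (ψ x).re) 2 volume := fun ψ => (ψ.memLp 2).re
    have e0 : ∀ x, (fderiv ℝ φ x (H1.grad w x)).re = ∑ i, (D i x).re * H1.grad w x i := by
      intro x
      have : H1.grad w x = ∑ i, H1.grad w x i • stdVec N i := by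
        conv_lhs => rw [← (EuclideanSpace.basisFun (Fin N) ℝ).sum_repr (H1.grad w x)]
        simp
      conv_lhs => rw [this]
      rw [map_sum, Complex.re_sum]
      refine Finset.sum_congr rfl fun i _ => ?_
      rw [map_smul, Complex.smul_re, hD, smul_eq_mul, mul_comm]
    have e1 : ∀ i x, (fderiv ℝ (D i) x (H1.val w x • stdVec N i)).re =
        (DD i x).re * H1.val w x := by
      intro i x
      rw [map_smul, Complex.smul_re, hDD, smul_eq_mul, mul_comm]
    simp only [e0] at k0
    simp only [e1] at k1
    have i1 : Integrable fun x => (φ x).re * H1.val w x := (l φ).integrable_mul (H1.memLp_val w)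
    have i2 : ∀ i, Integrable fun x => (D i x).re * H1.grad w x i := fun i =>
      (l _).integrable_mul (H1.memLp_grad_apply w i)
    have i3 : ∀ i, Integrable fun x => (DD i x).re * H1.val w x :=
      fun i => (l _).integrable_mul (H1.memLp_val w)
    have i4 : ∀ i, Integrable fun x => (D i x).re * H1.grad w x i + (DD i x).re * H1.val w x :=
      fun i => (i2 i).add (i3 i)
    have k2 : ∫ x, ∑ i, ((D i x).re * H1.grad w x i + (DD i x).re * H1.val w x) = 0 := by
      rw [integral_finsetSum _ fun i _ => i4 i]
      exact Finset.sum_eq_zero fun i _ => k1 i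
    have k3 : ∫ x, (((φ x).re * H1.val w x + ∑ i, (D i x).re * H1.grad w x i) -
        ∑ i, ((D i x).re * H1.grad w x i + (DD i x).re * H1.val w x)) = 0 := by
      have i5 : Integrable fun x => (φ x).re * H1.val w x + ∑ i, (D i x).re * H1.grad w x i :=
        i1.add (integrable_finsetSum _ fun i _ => i2 i)
      rw [integral_sub i5 (integrable_finsetSum _ fun i _ => i4 i), k0, k2, sub_zero]
    rw [← k3]
    congr 1
    ext x
    have hΔ : (Δ φ) x = ∑ i, DD i x := by
      rw [SchwartzMap.laplacian_eq_sum (EuclideanSpace.basisFun (Fin N) ℝ), sum_apply]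
      simp only [EuclideanSpace.basisFun_apply]
      rfl
    rw [sub_apply, hΔ, Complex.sub_re, Complex.re_sum, Finset.sum_add_distrib, sub_mul,
      Finset.sum_mul]
    ring
  have hz : ∀ᵐ x, H1.val w x = 0 := by
    refine ae_eq_zero_of_integral_contDiff_smul_eq_zero hloc fun g hg hc => ?_
    have hgt : IsTest fun x => (g x : ℂ) := (IsTest.mk hg hc).clm_comp Complex.ofRealCLM
    obtain ⟨φ, hφ⟩ := exists_sub_laplacian_eq (hgt.hasCompactSupport.toSchwartzMap hgt.contDiff)
    have := hS φ
    rw [hφ] at this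
    exact this
  have hgz : ∀ i, ∀ᵐ x, H1.grad w x i = 0 := fun i => by
    refine ae_eq_zero_of_integral_contDiff_smul_eq_zero
      ((H1.memLp_grad_apply w i).locallyIntegrable one_le_two) fun g hg hc => ?_
    have := (H1.hasWeakPartial w i).integral_eq g hg hc
    rw [← neg_eq_zero, ← this]
    exact integral_eq_zero_of_ae (by filter_upwards [hz] with x hx; simp [hx])
  refine H1.ext (Filter.EventuallyEq.trans hz H1.val_zero.symm) ?_
  filter_upwards [ae_all_iff.2 hgz, Lp.coeFn_zero (Space N) 2 (volume : Measure (Space N))]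
    with x hx h0
  ext i
  exact (hx i).trans (congrArg (fun y : Space N => y i) h0).symm

/-- Test functions, as a subspace of `H¹`. -/
def H1.testSubmodule (N : ℕ) : Submodule ℝ (H1 N) where
  carrier := {u | ∃ (φ : Space N → ℝ) (h : IsTest φ), H1.ofTest h = u}
  zero_mem' := ⟨fun _ => 0, ⟨contDiff_const, HasCompactSupport.zero⟩, by
    refine H1.ext ((H1.val_ofTest _).trans H1.val_zero.symm) ?_
    filter_upwards [H1.grad_ofTest ⟨contDiff_const, HasCompactSupport.zero⟩,
      Lp.coeFn_zero (Space N) 2 (volume : Measure (Space N))] with x hx h0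
    rw [hx]
    refine Eq.trans ?_ h0.symm
    simp [gradient]⟩
  add_mem' := by
    rintro _ _ ⟨φ, h, rfl⟩ ⟨χ, h', rfl⟩
    refine ⟨_, h.add h', H1.ext ?_ ?_⟩
    · filter_upwards [H1.val_ofTest h, H1.val_ofTest h', H1.val_ofTest (h.add h'),
        H1.val_add (H1.ofTest h) (H1.ofTest h')] with x h1 h2 h3 h4
      rw [h4, h3, h1, h2]
    · filter_upwards [H1.grad_ofTest h, H1.grad_ofTest h', H1.grad_ofTest (h.add h'),
        H1.grad_add (H1.ofTest h) (H1.ofTest h')] with x h1 h2 h3 h4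
      rw [h4, h3, h1, h2, gradient, fderiv_fun_add (h.differentiable x) (h'.differentiable x),
        map_add]
      rfl
  smul_mem' := by
    rintro c _ ⟨φ, h, rfl⟩
    have hc := IsTest.smul_left (contDiff_const (c := c)) h
    refine ⟨_, hc, H1.ext ?_ ?_⟩
    · filter_upwards [H1.val_ofTest h, H1.val_ofTest hc, H1.val_smul c (H1.ofTest h)]
        with x h1 h2 h3
      rw [h3, h2, h1, smul_eq_mul]
    · filter_upwards [H1.grad_ofTest h, H1.grad_ofTest hc, H1.grad_smul c (H1.ofTest h)]
        with x h1 h2 h3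
      rw [h3, h2, h1, gradient, fderiv_fun_const_smul (h.differentiable x), map_smul]
      rfl

theorem H1.dense_ofTest :
    Dense {u : H1 N | ∃ (φ : Space N → ℝ) (h : IsTest φ), H1.ofTest h = u} := by
  have : (H1.testSubmodule N).topologicalClosure = ⊤ := by
    rw [Submodule.topologicalClosure_eq_top_iff, Submodule.eq_bot_iff]
    intro w hw
    refine H1.eq_zero_of_forall_inner_ofTest fun φ h => ?_
    exact (Submodule.mem_orthogonal' _ _).1 hw _ ⟨φ, h, rfl⟩
  exact (Submodule.dense_iff_topologicalClosure_eq_top (s := H1.testSubmodule N)).2 this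

end Density
end NKG
end

noncomputable section
namespace NKG

/-! ### The subcritical Sobolev embedding -/

section Sobolev
open scoped ENNReal NNReal
variable {N : ℕ}

theorem H1.eLpNorm_val_le (u : H1 N) : eLpNorm (H1.val u) 2 volume ≤ ENNReal.ofReal ‖u‖ := by
  have : eLpNorm (H1.val u) 2 volume = ENNReal.ofReal ‖H1.toL2 N u‖ := by
    rw [Lp.norm_def, ENNReal.ofReal_toReal (Lp.eLpNorm_ne_top _)]
    rfl
  rw [this]
  exact ENNReal.ofReal_le_ofReal (H1.norm_toL2_le u)

theorem H1.eLpNorm_grad_le (u : H1 N) : eLpNorm (H1.grad u) 2 volume ≤ ENNReal.ofReal ‖u‖ := by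
  have : eLpNorm (H1.grad u) 2 volume = ENNReal.ofReal ‖H1.gradL2 N u‖ := by
    rw [Lp.norm_def, ENNReal.ofReal_toReal (Lp.eLpNorm_ne_top _)]
    rfl
  rw [this]
  exact ENNReal.ofReal_le_ofReal (H1.norm_gradL2_le u)

theorem IsTest.eLpNorm_le {φ : Space N → ℝ} (h : IsTest φ) :
    eLpNorm φ 2 volume ≤ ENNReal.ofReal ‖H1.ofTest h‖ :=
  (eLpNorm_congr_ae (H1.val_ofTest h)).symm.trans_le (H1.eLpNorm_val_le _)

theorem IsTest.eLpNorm_fderiv_le {φ : Space N → ℝ} (h : IsTest φ) :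
    eLpNorm (fderiv ℝ φ) 2 volume ≤ ENNReal.ofReal ‖H1.ofTest h‖ := by
  have e1 : eLpNorm (fderiv ℝ φ) 2 volume = eLpNorm (_root_.gradient φ) 2 volume :=
    eLpNorm_congr_norm_ae (by filter_upwards with x using (norm_gradient φ x).symm)
  rw [e1]
  exact (eLpNorm_congr_ae (H1.grad_ofTest h)).symm.trans_le (H1.eLpNorm_grad_le _)

/-- In dimension at least three test functions obey the critical Sobolev inequality. -/
theorem exists_eLpNorm_test_le_of_three_le (hN : 2 < N) (r : ℝ≥0)
    (hr : (r : ℝ) = 2 * (N : ℝ) / ((N : ℝ) - 2)) :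
    ∃ K : ℝ≥0, ∀ (φ : Space N → ℝ) (h : IsTest φ),
      eLpNorm φ r volume ≤ K * ENNReal.ofReal ‖H1.ofTest h‖ := by
  refine ⟨SNormLESNormFDerivOfEqConst ℝ (volume : Measure (Space N)) 2, fun φ h => ?_⟩
  have hN' : (2 : ℝ) < N := by exact_mod_cast hN
  have := eLpNorm_le_eLpNorm_fderiv_of_eq (F := ℝ) (volume : Measure (Space N)) (u := φ)
    (h.contDiff.of_le (by norm_cast)) h.hasCompactSupport
    (p := 2) (p' := r) (by norm_num) (by simp; omega) (by
      rw [hr, finrank_euclideanSpace_fin]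
      have : (N : ℝ) - 2 ≠ 0 := by linarith
      push_cast
      field_simp)
  exact this.trans (mul_le_mul_right h.eLpNorm_fderiv_le _)

/-- One step of the two-dimensional bootstrap: the Gagliardo–Nirenberg inequality
`‖w‖_{L²} ≤ C ‖∇w‖_{L¹}` for `w = φ ^ (k + 1)`, followed by the Cauchy–Schwarz inequality. -/
theorem lintegral_pow_succ_le (hN : N = 2) (k : ℕ) : ∃ K : ℝ≥0, ∀ (φ : Space N → ℝ), IsTest φ →
    ∫⁻ x, ‖φ x‖ₑ ^ (2 * (k + 1)) ≤
      K * (∫⁻ x, ‖φ x‖ₑ ^ (2 * k)) * ∫⁻ x, ‖fderiv ℝ φ x‖ₑ ^ 2 := by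
  have hp : Real.HolderConjugate (Module.finrank ℝ (Space N)) (2 : ℝ) := by
    rw [finrank_euclideanSpace_fin, hN]
    exact_mod_cast Real.HolderConjugate.two_two
  refine ⟨lintegralPowLePowLIntegralFDerivConst (volume : Measure (Space N)) 2 * (k + 1) ^ 2,
    fun φ h => ?_⟩
  have hw : IsTest fun x => φ x ^ (k + 1) := ⟨h.contDiff.pow _, by
    simp only [pow_succ']
    exact h.hasCompactSupport.mul_right⟩
  have h1 := lintegral_pow_le_pow_lintegral_fderiv (volume : Measure (Space N))
    (u := fun x => φ x ^ (k + 1)) (hw.contDiff.of_le (by norm_cast)) hw.hasCompactSupport hp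
  have h2 : ∀ x, ‖fderiv ℝ (fun x => φ x ^ (k + 1)) x‖ₑ =
      (k + 1 : ℝ≥0) * (‖φ x‖ₑ ^ k * ‖fderiv ℝ φ x‖ₑ) := by
    intro x
    have hk : ‖(k : ℝ) + 1‖ₑ = ((k + 1 : ℝ≥0) : ℝ≥0∞) := by
      rw [← Nat.cast_succ, Real.enorm_natCast]
      push_cast
      rfl
    rw [fderiv_fun_pow _ (h.differentiable x), enorm_smul, nsmul_eq_mul, enorm_mul, enorm_pow,
      Nat.add_sub_cancel, Nat.cast_succ, hk, mul_assoc]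
  have hmφ : Measurable fun x => ‖φ x‖ₑ := h.continuous.measurable.enorm
  have hmD : Measurable fun x => ‖fderiv ℝ φ x‖ₑ :=
    (h.contDiff.continuous_fderiv (by simp)).measurable.enorm
  have h3 : (∫⁻ x, ‖φ x‖ₑ ^ k * ‖fderiv ℝ φ x‖ₑ) ^ 2 ≤
      (∫⁻ x, ‖φ x‖ₑ ^ (2 * k)) * ∫⁻ x, ‖fderiv ℝ φ x‖ₑ ^ 2 := by
    have := ENNReal.lintegral_mul_le_Lp_mul_Lq (volume : Measure (Space N))
      Real.HolderConjugate.two_two (hmφ.pow_const k).aemeasurable hmD.aemeasurable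
    simp only [Pi.mul_apply, ENNReal.rpow_two, ← pow_mul] at this
    refine (pow_le_pow_left₀ zero_le this 2).trans_eq ?_
    rw [mul_pow, ← ENNReal.rpow_natCast, ← ENNReal.rpow_natCast, ← ENNReal.rpow_mul,
      ← ENNReal.rpow_mul]
    simp [mul_comm k 2]
  simp only [h2, ENNReal.rpow_two, enorm_pow, ← pow_mul] at h1
  have hm : Measurable fun x => ‖φ x‖ₑ ^ k * ‖fderiv ℝ φ x‖ₑ := (hmφ.pow_const k).mul hmD
  rw [lintegral_const_mul _ hm, mul_pow] at h1
  rw [mul_comm 2 (k + 1)]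
  refine h1.trans ?_
  push_cast
  rw [mul_assoc, ← mul_assoc]
  gcongr

theorem lintegral_enorm_pow_eq {α V : Type*} [MeasurableSpace α] [NormedAddCommGroup V]
    {μ : Measure α} (f : α → V) {n : ℕ} (hn : n ≠ 0) :
    ∫⁻ x, ‖f x‖ₑ ^ n ∂μ = eLpNorm f n μ ^ n := by
  have := eLpNorm_nnreal_pow_eq_lintegral (f := f) (μ := μ) (p := n) (by exact_mod_cast hn)
  simp only [NNReal.coe_natCast, ENNReal.rpow_natCast, ENNReal.coe_natCast] at this
  exact this.symm

/-- In dimension two test functions obey a Sobolev inequality for every even exponent. -/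
theorem exists_eLpNorm_test_le_of_two (hN : N = 2) (k : ℕ) :
    ∃ K : ℝ≥0, ∀ (φ : Space N → ℝ) (h : IsTest φ),
      eLpNorm φ (2 * (k + 1) : ℕ) volume ≤ K * ENNReal.ofReal ‖H1.ofTest h‖ := by
  induction k with
  | zero => exact ⟨1, fun φ h => by simpa using h.eLpNorm_le⟩
  | succ k ih =>
    obtain ⟨K, hK⟩ := ih
    obtain ⟨K', hK'⟩ := lintegral_pow_succ_le hN (k + 1)
    refine ⟨(K' * K ^ (2 * (k + 1))) ^ ((2 * (k + 2) : ℕ) : ℝ)⁻¹, fun φ h => ?_⟩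
    have h0 := hK' φ h
    have hD : ∫⁻ x, ‖fderiv ℝ φ x‖ₑ ^ 2 ≤ ENNReal.ofReal ‖H1.ofTest h‖ ^ 2 := by
      rw [lintegral_enorm_pow_eq _ two_ne_zero]
      have := h.eLpNorm_fderiv_le
      push_cast
      gcongr
    have hφ : ∫⁻ x, ‖φ x‖ₑ ^ (2 * (k + 1)) ≤
        (K * ENNReal.ofReal ‖H1.ofTest h‖) ^ (2 * (k + 1)) := by
      rw [lintegral_enorm_pow_eq _ (by omega)]
      have := hK φ h
      gcongr
    rw [lintegral_enorm_pow_eq _ (by omega)] at h0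
    have hpos : (0 : ℝ) < (2 * (k + 2) : ℕ) := by positivity
    rw [← ENNReal.rpow_le_rpow_iff hpos, ENNReal.rpow_natCast]
    refine h0.trans ?_
    rw [ENNReal.mul_rpow_of_nonneg _ _ hpos.le, ENNReal.coe_rpow_of_nonneg _ (by positivity),
      ← ENNReal.rpow_mul, inv_mul_cancel₀ hpos.ne', ENNReal.rpow_one, ENNReal.rpow_natCast]
    calc (K' : ℝ≥0∞) * (∫⁻ x, ‖φ x‖ₑ ^ (2 * (k + 1))) * ∫⁻ x, ‖fderiv ℝ φ x‖ₑ ^ 2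
        ≤ K' * (K * ENNReal.ofReal ‖H1.ofTest h‖) ^ (2 * (k + 1)) *
          ENNReal.ofReal ‖H1.ofTest h‖ ^ 2 := by gcongr
      _ = _ := by push_cast; ring

/-- Sobolev inequalities pass from test functions to `H¹` by density and Fatou's lemma. -/
theorem H1.eLpNorm_val_le_of_test {r : ℝ≥0∞} {K : ℝ≥0}
    (hK : ∀ (φ : Space N → ℝ) (h : IsTest φ),
      eLpNorm φ r volume ≤ K * ENNReal.ofReal ‖H1.ofTest h‖) (u : H1 N) :
    eLpNorm (H1.val u) r volume ≤ K * ENNReal.ofReal ‖u‖ := by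
  obtain ⟨v, hv, hlim⟩ := mem_closure_iff_seq_limit.1 (H1.dense_ofTest u)
  choose φ hφ hφv using hv
  have hL2 : Filter.Tendsto (fun n => H1.toL2 N (v n)) Filter.atTop (𝓝 (H1.toL2 N u)) :=
    ((H1.toL2 N).continuous.tendsto u).comp hlim
  obtain ⟨ns, hns, hae⟩ := (tendstoInMeasure_of_tendsto_Lp hL2).exists_seq_tendsto_ae
  have hle : ∀ n, eLpNorm (H1.val (v n)) r volume ≤ K * ENNReal.ofReal ‖v n‖ := by
    intro n
    have := hK (φ n) (hφ n)
    rwa [← eLpNorm_congr_ae (H1.val_ofTest (hφ n)), hφv n] at this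
  refine (Lp.eLpNorm_lim_le_liminf_eLpNorm (f := fun n => H1.val (v (ns n)))
    (fun n => (H1.memLp_val _).aestronglyMeasurable) (H1.val u) hae).trans ?_
  have ht : Filter.Tendsto (fun n => (K : ℝ≥0∞) * ENNReal.ofReal ‖v (ns n)‖) Filter.atTop
      (𝓝 (K * ENNReal.ofReal ‖u‖)) :=
    ENNReal.Tendsto.const_mul (ENNReal.tendsto_ofReal ((hlim.comp hns.tendsto_atTop).norm))
      (Or.inr ENNReal.coe_ne_top)
  rw [← ht.liminf_eq]
  exact Filter.liminf_le_liminf (Filter.Eventually.of_forall fun n => hle _)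

/-- **Sobolev embedding** `H¹ ⊂ L^q` for `2 < q < 2*`. -/
theorem H1.exists_integral_rpow_le (hN : 2 ≤ N) {q : ℝ} (hq : 2 < q)
    (hq' : 2 < N → q < 2 * (N : ℝ) / ((N : ℝ) - 2)) :
    ∃ K : ℝ, 0 ≤ K ∧ ∀ u : H1 N, Integrable (fun x => |H1.val u x| ^ q) ∧
      ∫ x, |H1.val u x| ^ q ≤ K * ‖u‖ ^ q := by
  obtain ⟨r, K, hqr, hK⟩ : ∃ r K : ℝ≥0, q ≤ r ∧ ∀ u : H1 N,
      eLpNorm (H1.val u) r volume ≤ K * ENNReal.ofReal ‖u‖ := by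
    rcases hN.eq_or_lt with h2 | h2
    · obtain ⟨k, hk⟩ := exists_nat_ge q
      obtain ⟨K, hK⟩ := exists_eLpNorm_test_le_of_two h2.symm k
      refine ⟨(2 * (k + 1) : ℕ), K, ?_, fun u => ?_⟩
      · push_cast
        linarith
      · have := H1.eLpNorm_val_le_of_test hK u
        exact_mod_cast this
    · have hN' : (2 : ℝ) < N := by exact_mod_cast h2
      have hr : 0 ≤ 2 * (N : ℝ) / ((N : ℝ) - 2) := by
        have : 0 < (N : ℝ) - 2 := by linarith
        positivity
      obtain ⟨K, hK⟩ := exists_eLpNorm_test_le_of_three_le h2 ⟨_, hr⟩ rfl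
      exact ⟨⟨_, hr⟩, K, (hq' h2).le, H1.eLpNorm_val_le_of_test hK⟩
  have hr0 : (0 : ℝ) < r := by linarith
  have hr0' : (r : ℝ≥0∞) ≠ 0 := by
    have : r ≠ 0 := by rintro rfl; simp at hr0
    exact_mod_cast this
  have hmemr : ∀ u : H1 N, MemLp (H1.val u) r volume := fun u =>
    ⟨(H1.memLp_val u).aestronglyMeasurable,
      (hK u).trans_lt (ENNReal.mul_lt_top ENNReal.coe_lt_top ENNReal.ofReal_lt_top)⟩
  have hintr : ∀ u : H1 N, Integrable fun x => |H1.val u x| ^ (r : ℝ) := fun u => by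
    have := (hmemr u).integrable_norm_rpow hr0' ENNReal.coe_ne_top
    simpa using this
  -- `|s|^q` lies between `|s|²` and `|s|^r`
  have hpt : ∀ s : ℝ, |s| ^ q ≤ s ^ 2 + |s| ^ (r : ℝ) := by
    intro s
    rcases le_total |s| 1 with h1 | h1
    · have : |s| ^ q ≤ |s| ^ (2 : ℝ) := by
        rcases (abs_nonneg s).eq_or_lt with h0 | h0
        · rw [← h0, Real.zero_rpow (by linarith), Real.zero_rpow two_ne_zero]
        · exact Real.rpow_le_rpow_of_exponent_ge h0 h1 hq.le
      rw [Real.rpow_two, sq_abs] at this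
      have := Real.rpow_nonneg (abs_nonneg s) (r : ℝ)
      linarith
    · have := Real.rpow_le_rpow_of_exponent_le h1 hqr
      nlinarith [sq_nonneg s]
  have hint : ∀ u : H1 N, Integrable fun x => |H1.val u x| ^ q := by
    intro u
    refine ((H1.integrable_val_sq u).add (hintr u)).mono' ?_ ?_
    · exact ((H1.memLp_val u).aestronglyMeasurable.norm.aemeasurable.pow_const
        q).aestronglyMeasurable
    · filter_upwards with x
      rw [Real.norm_of_nonneg (by positivity)]
      exact hpt _
  -- both sides are homogeneous of degree `q`, so unit vectors suffice
  have hone : ∀ w : H1 N, ‖w‖ = 1 → ∫ x, |H1.val w x| ^ q ≤ 1 + (K : ℝ) ^ (r : ℝ) := by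
    intro w hw
    have h1 : ∫ x, |H1.val w x| ^ q ≤ ∫ x, (H1.val w x ^ 2 + |H1.val w x| ^ (r : ℝ)) :=
      integral_mono (hint w) ((H1.integrable_val_sq w).add (hintr w)) fun x => hpt _
    rw [integral_add (H1.integrable_val_sq w) (hintr w)] at h1
    have h2 := H1.integral_val_sq_le w
    rw [hw, one_pow] at h2
    have h3 : ∫ x, |H1.val w x| ^ (r : ℝ) ≤ (K : ℝ) ^ (r : ℝ) := by
      have e1 := eLpNorm_nnreal_pow_eq_lintegral (f := H1.val w) (μ := volume) (p := r)
        (by exact_mod_cast hr0')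
      have e2 := hK w
      rw [hw, ENNReal.ofReal_one, mul_one] at e2
      rw [integral_eq_lintegral_of_nonneg_ae
        (by filter_upwards with x using Real.rpow_nonneg (abs_nonneg _) _)
        (hintr w).aestronglyMeasurable]
      refine ENNReal.toReal_le_of_le_ofReal (by positivity) ?_
      have e3 : ∀ x, ENNReal.ofReal (|H1.val w x| ^ (r : ℝ)) = ‖H1.val w x‖ₑ ^ (r : ℝ) := by
        intro x
        rw [← ENNReal.ofReal_rpow_of_nonneg (abs_nonneg _) hr0.le, ← Real.enorm_eq_ofReal_abs]
      simp only [e3]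
      have e4 : ENNReal.ofReal ((K : ℝ) ^ (r : ℝ)) = (K : ℝ≥0∞) ^ (r : ℝ) := by
        rw [← ENNReal.ofReal_rpow_of_nonneg (NNReal.coe_nonneg K) hr0.le,
          ENNReal.ofReal_coe_nnreal]
      rw [← e1, e4]
      gcongr
    linarith
  refine ⟨1 + (K : ℝ) ^ (r : ℝ), by positivity, fun u => ⟨hint u, ?_⟩⟩
  rcases eq_or_ne u 0 with rfl | hu
  · rw [norm_zero, Real.zero_rpow (by linarith), mul_zero]
    refine (integral_eq_zero_of_ae ?_).le
    filter_upwards [H1.val_zero (N := N)] with x hx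
    rw [hx, abs_zero, Real.zero_rpow (by linarith)]
    rfl
  · have hn : 0 < ‖u‖ := norm_pos_iff.2 hu
    have hw := hone (‖u‖⁻¹ • u) (by rw [norm_smul, norm_inv, norm_norm, inv_mul_cancel₀ hn.ne'])
    have e : ∫ x, |H1.val (‖u‖⁻¹ • u) x| ^ q = (‖u‖ ^ q)⁻¹ * ∫ x, |H1.val u x| ^ q := by
      rw [← integral_const_mul]
      refine integral_congr_ae ?_
      filter_upwards [H1.val_smul ‖u‖⁻¹ u] with x hx
      rw [hx, abs_mul, abs_of_pos (inv_pos.2 hn), Real.mul_rpow (by positivity) (abs_nonneg _),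
        Real.inv_rpow hn.le]
    rw [e, inv_mul_le_iff₀ (by positivity)] at hw
    linarith

end Sobolev
end NKG
end

noncomputable section
namespace NKG

/-! ### Pointwise bounds on the nonlinearity -/

section Nonlinearity

/-- The restriction `s ↦ F |s|` of the potential to the real line. -/
def realPotential (F : ℝ → ℝ) (s : ℝ) : ℝ := F |s|

/-- The derivative `F'(|s|) s / |s|` of the potential on the real line; it vanishes at `0`
because `0 / 0 = 0`. -/
def realPotentialDeriv (F : ℝ → ℝ) (s : ℝ) : ℝ := deriv F |s| * (s / |s|)

theorem hasDerivAt_of_eq_on_half_lines {f f₁ f₂ : ℝ → ℝ} {d s : ℝ}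
    (h₁ : 0 ≤ s → HasDerivAt f₁ d s) (h₂ : s ≤ 0 → HasDerivAt f₂ d s)
    (e₁ : ∀ t, 0 ≤ t → f t = f₁ t) (e₂ : ∀ t, t ≤ 0 → f t = f₂ t) : HasDerivAt f d s := by
  have k₁ : HasDerivWithinAt f d (Set.Ici 0) s := by
    by_cases hs : 0 ≤ s
    · exact (h₁ hs).hasDerivWithinAt.congr (fun t ht => e₁ t ht) (e₁ s hs)
    · exact HasFDerivWithinAt.of_notMem_closure (by simpa [closure_Ici] using hs)
  have k₂ : HasDerivWithinAt f d (Set.Iic 0) s := by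
    by_cases hs : s ≤ 0
    · exact (h₂ hs).hasDerivWithinAt.congr (fun t ht => e₂ t ht) (e₂ s hs)
    · exact HasFDerivWithinAt.of_notMem_closure (by simpa [closure_Iic] using hs)
  have := k₂.union k₁
  rwa [Set.Iic_union_Ici, hasDerivWithinAt_univ] at this

theorem hasDerivAt_deriv {F : ℝ → ℝ} (hF : ContDiff ℝ 2 F) (s : ℝ) :
    HasDerivAt (deriv F) (iteratedDeriv 2 F s) s := by
  rw [iteratedDeriv_succ, iteratedDeriv_one]
  exact ((hF.iterate_deriv' 1 1).differentiable (by norm_num) s).hasDerivAt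

variable {F : ℝ → ℝ}

theorem hasDerivAt_realPotential (hF : ContDiff ℝ 2 F) (h0 : Normalized F) (s : ℝ) :
    HasDerivAt (realPotential F) (realPotentialDeriv F s) s := by
  have hd : ∀ t, HasDerivAt F (deriv F t) t := fun t =>
    (hF.differentiable (by norm_num) t).hasDerivAt
  refine hasDerivAt_of_eq_on_half_lines (f₁ := F) (f₂ := fun t => F (-t)) ?_ ?_
    (fun t ht => by rw [realPotential, abs_of_nonneg ht])
    (fun t ht => by rw [realPotential, abs_of_nonpos ht])
  · intro hs
    convert hd s using 1
    rcases hs.eq_or_lt with rfl | hs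
    · simp [realPotentialDeriv, h0.deriv_zero]
    · rw [realPotentialDeriv, abs_of_pos hs, div_self hs.ne', mul_one]
  · intro hs
    have : HasDerivAt (fun t => F (-t)) (deriv F (-s) * -1) s :=
      (hd (-s)).comp s (hasDerivAt_neg s)
    refine this.congr_deriv ?_
    rcases hs.eq_or_lt with rfl | hs
    · simp [realPotentialDeriv, h0.deriv_zero]
    · rw [realPotentialDeriv, abs_of_neg hs, div_neg, div_self hs.ne]

theorem hasDerivAt_realPotentialDeriv (hF : ContDiff ℝ 2 F) (h0 : Normalized F) (s : ℝ) :
    HasDerivAt (realPotentialDeriv F) (iteratedDeriv 2 F |s|) s := by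
  refine hasDerivAt_of_eq_on_half_lines (f₁ := deriv F) (f₂ := fun t => -deriv F (-t)) ?_ ?_ ?_ ?_
  · intro hs
    rw [abs_of_nonneg hs]
    exact hasDerivAt_deriv hF s
  · intro hs
    rw [abs_of_nonpos hs]
    have : HasDerivAt (fun t => -deriv F (-t)) (-(iteratedDeriv 2 F (-s) * -1)) s :=
      ((hasDerivAt_deriv hF (-s)).comp s (hasDerivAt_neg s)).neg
    exact this.congr_deriv (by ring)
  · intro t ht
    rcases ht.eq_or_lt with rfl | ht
    · simp [realPotentialDeriv, h0.deriv_zero]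
    · rw [realPotentialDeriv, abs_of_pos ht, div_self ht.ne', mul_one]
  · intro t ht
    rcases ht.eq_or_lt with rfl | ht
    · simp [realPotentialDeriv, h0.deriv_zero]
    · rw [realPotentialDeriv, abs_of_neg ht, div_neg, div_self ht.ne, mul_neg, mul_one]

/-- The growth conditions on a potential `G` with derivative `g` that make `∫ G(u)` differentiable
on a space embedded in `L² ∩ L^q`: a bound on `g`, and a quadratic bound on the first-order Taylor
remainder of `G`. -/
structure PowerGrowth (G g : ℝ → ℝ) (A q : ℝ) : Prop where
  continuous : Continuous G
  continuous_deriv : Continuous g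
  zero : G 0 = 0
  deriv_zero : g 0 = 0
  nonneg : 0 ≤ A
  two_lt : 2 < q
  abs_deriv_le : ∀ s, |g s| ≤ A * (|s| + |s| ^ (q - 1))
  abs_remainder_le : ∀ s h, |G (s + h) - G s - g s * h| ≤ A * (1 + (|s| + |h|) ^ (q - 2)) * h ^ 2

/-- Subcritical growth of the remainder bounds `F''` by a multiple of `1 + s ^ (q - 2)`. -/
theorem exists_powerGrowth {N : ℕ} (hF : ContDiff ℝ 2 F) (h0 : Normalized F)
    (hg : SubcriticalGrowth N F) :
    ∃ A q : ℝ, PowerGrowth (realPotential F) (realPotentialDeriv F) A q ∧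
      (2 < N → q < 2 * (N : ℝ) / ((N : ℝ) - 2)) := by
  obtain ⟨c₁, c₂, p, q, hc₁, hc₂, hp, hpq, hq, hb⟩ := hg
  have hF2 : ∀ s, 0 ≤ s → |iteratedDeriv 2 F s| ≤ (1 + c₁ + c₂) * (1 + s ^ (q - 2)) := by
    intro s hs
    have e : iteratedDeriv 2 (remainder F) s = iteratedDeriv 2 F s - 1 := by
      have h1 : deriv (remainder F) = fun t => deriv F t - t := by
        ext t
        have : HasDerivAt (remainder F) (deriv F t - (2 * t) / 2) t :=
          ((hF.differentiable (by norm_num) t).hasDerivAt).sub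
            (((hasDerivAt_pow 2 t).congr_deriv (by norm_num)).div_const 2)
        rw [this.deriv]
        ring
      rw [iteratedDeriv_succ, iteratedDeriv_one, h1]
      exact ((hasDerivAt_deriv hF s).sub (hasDerivAt_id s)).deriv
    have h1 := hb s hs
    rw [e] at h1
    have h2 : s ^ (p - 2) ≤ 1 + s ^ (q - 2) := by
      rcases le_total s 1 with h | h
      · have := Real.rpow_le_one hs h (by linarith : 0 ≤ p - 2)
        have := Real.rpow_nonneg hs (q - 2)
        linarith
      · have := Real.rpow_le_rpow_of_exponent_le h (by linarith : p - 2 ≤ q - 2)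
        linarith
    have h3 := Real.rpow_nonneg hs (q - 2)
    have h4 := abs_sub_abs_le_abs_sub (iteratedDeriv 2 F s) 1
    rw [abs_one] at h4
    nlinarith
  set A := 1 + c₁ + c₂
  have hA : 0 ≤ A := by positivity
  have hq2 : 0 ≤ q - 2 := by linarith
  have hcont : Continuous (realPotential F) := continuous_iff_continuousAt.2 fun s =>
    (hasDerivAt_realPotential hF h0 s).continuousAt
  have hcont' : Continuous (realPotentialDeriv F) := continuous_iff_continuousAt.2 fun s =>
    (hasDerivAt_realPotentialDeriv hF h0 s).continuousAt
  have hz : realPotentialDeriv F 0 = 0 := by simp [realPotentialDeriv]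
  -- the mean value inequality on `[-M, M]`
  have hlip : ∀ M s t : ℝ, |s| ≤ M → |t| ≤ M →
      |realPotentialDeriv F t - realPotentialDeriv F s| ≤ A * (1 + M ^ (q - 2)) * |t - s| := by
    intro M s t hs ht
    refine (convex_Icc (-M) M).norm_image_sub_le_of_norm_hasDerivWithin_le
      (f := realPotentialDeriv F)
      (fun x _ => (hasDerivAt_realPotentialDeriv hF h0 x).hasDerivWithinAt) (fun x hx => ?_)
      (abs_le.1 hs) (abs_le.1 ht)
    refine (hF2 _ (abs_nonneg x)).trans ?_
    have := abs_le.2 hx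
    gcongr
  refine ⟨A, q, ⟨hcont, hcont', by simp [realPotential, h0.zero], hz, hA, by linarith, ?_, ?_⟩, hq⟩
  · intro s
    have := hlip |s| 0 s (by simp) le_rfl
    rw [hz, sub_zero, sub_zero] at this
    refine this.trans_eq ?_
    have e : |s| ^ (q - 1) = |s| ^ (q - 2) * |s| := by
      rw [← Real.rpow_add_one' (abs_nonneg s) (by linarith)]
      ring_nf
    rw [e]
    ring
  · intro s h
    have hM : ∀ x ∈ Set.uIcc s (s + h), |x - s| ≤ |h| ∧ |x| ≤ |s| + |h| := by
      intro x hx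
      have h1 : |x - s| ≤ |h| := by
        have := Set.abs_sub_left_of_mem_uIcc hx
        simpa using this
      refine ⟨h1, ?_⟩
      have := abs_add_le (x - s) s
      rw [sub_add_cancel] at this
      linarith
    have := (convex_uIcc s (s + h)).norm_image_sub_le_of_norm_hasDerivWithin_le
      (f := fun x => realPotential F x - realPotentialDeriv F s * x)
      (f' := fun x => realPotentialDeriv F x - realPotentialDeriv F s)
      (C := A * (1 + (|s| + |h|) ^ (q - 2)) * |h|)
      (fun x _ => by
        have : HasDerivAt (fun x => realPotential F x - realPotentialDeriv F s * x)
            (realPotentialDeriv F x - realPotentialDeriv F s * 1) x :=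
          (hasDerivAt_realPotential hF h0 x).sub
            ((hasDerivAt_id x).const_mul (realPotentialDeriv F s))
        rw [mul_one] at this
        exact this.hasDerivWithinAt) (fun x hx => ?_)
      Set.left_mem_uIcc Set.right_mem_uIcc
    · rw [Real.norm_eq_abs, Real.norm_eq_abs, add_sub_cancel_left] at this
      calc _ = |realPotential F (s + h) - realPotentialDeriv F s * (s + h) -
            (realPotential F s - realPotentialDeriv F s * s)| := by
            congr 1
            ring
        _ ≤ _ := this
        _ = _ := by rw [mul_assoc, ← abs_mul, ← sq, abs_of_nonneg (sq_nonneg h)]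
    · obtain ⟨h1, h2⟩ := hM x hx
      refine (hlip (|s| + |h|) s x (by linarith [abs_nonneg h]) h2).trans ?_
      gcongr

variable {G g : ℝ → ℝ} {A q : ℝ}

theorem rpow_add_le_two_rpow_mul {a b : ℝ} (ha : 0 ≤ a) (hb : 0 ≤ b) (hq : 0 ≤ q) :
    (a + b) ^ q ≤ 2 ^ q * (a ^ q + b ^ q) := by
  have h1 : (a + b) ^ q ≤ (2 * max a b) ^ q := by
    gcongr
    linarith [le_max_left a b, le_max_right a b]
  have h2 : (max a b) ^ q ≤ a ^ q + b ^ q := by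
    have := Real.rpow_nonneg ha q
    have := Real.rpow_nonneg hb q
    rcases max_choice a b with h | h <;> rw [h] <;> linarith
  rw [Real.mul_rpow zero_le_two (le_max_of_le_left ha)] at h1
  exact h1.trans (by gcongr)

theorem PowerGrowth.abs_deriv_mul_le (hG : PowerGrowth G g A q) (s k : ℝ) :
    |g s * k| ≤ A * (s ^ 2 + k ^ 2 + |s| ^ q + |k| ^ q) := by
  have hq := hG.two_lt
  have h1 : |s| * |k| ≤ s ^ 2 + k ^ 2 := by
    rw [← sq_abs s, ← sq_abs k]
    nlinarith [sq_nonneg (|s| - |k|), sq_nonneg |s|, sq_nonneg |k|]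
  have h2 : |s| ^ (q - 1) * |k| ≤ |s| ^ q + |k| ^ q := by
    have e : ∀ t : ℝ, |t| ^ q = |t| ^ (q - 1) * |t| := fun t => by
      rw [← Real.rpow_add_one' (abs_nonneg t) (by linarith), sub_add_cancel]
    have hs := Real.rpow_nonneg (abs_nonneg s) q
    have hk := Real.rpow_nonneg (abs_nonneg k) q
    rcases le_total |s| |k| with h | h
    · have : |s| ^ (q - 1) * |k| ≤ |k| ^ (q - 1) * |k| := by
        have : 0 ≤ q - 1 := by linarith
        gcongr
      rw [← e] at this
      linarith
    · have : |s| ^ (q - 1) * |k| ≤ |s| ^ (q - 1) * |s| := by gcongr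
      rw [← e] at this
      linarith
  rw [abs_mul]
  calc |g s| * |k| ≤ (A * (|s| + |s| ^ (q - 1))) * |k| := by
        gcongr
        exact hG.abs_deriv_le s
    _ = A * (|s| * |k| + |s| ^ (q - 1) * |k|) := by ring
    _ ≤ _ := mul_le_mul_of_nonneg_left (by linarith) hG.nonneg

/-- The Taylor remainder at increments of size `ε`. Rescaling the increment replaces Hölder's
inequality by a pointwise bound. -/
theorem PowerGrowth.abs_remainder_scaled_le (hG : PowerGrowth G g A q) {ε : ℝ} (h0 : 0 ≤ ε)
    (h1 : ε ≤ 1) (s k : ℝ) : |G (s + ε * k) - G s - g s * (ε * k)| ≤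
      ε ^ 2 * (A * (k ^ 2 + 2 ^ q * (|s| ^ q + |k| ^ q))) := by
  have hq := hG.two_lt
  have hA := hG.nonneg
  have e1 : (|s| + |ε * k|) ^ (q - 2) * k ^ 2 ≤ 2 ^ q * (|s| ^ q + |k| ^ q) := by
    refine le_trans ?_ (rpow_add_le_two_rpow_mul (abs_nonneg s) (abs_nonneg k) (by linarith))
    have e : (|s| + |k|) ^ q = (|s| + |k|) ^ (q - 2) * (|s| + |k|) ^ 2 := by
      rw [← Real.rpow_two, ← Real.rpow_add_of_nonneg (by positivity) (by linarith) zero_le_two,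
        sub_add_cancel]
    rw [e]
    have h2 : |ε * k| ≤ |k| := by
      rw [abs_mul, abs_of_nonneg h0]
      nlinarith [abs_nonneg k]
    have h3 : k ^ 2 ≤ (|s| + |k|) ^ 2 := by
      rw [← sq_abs k]
      gcongr
      linarith [abs_nonneg s]
    have h4 : 0 ≤ q - 2 := by linarith
    gcongr
  calc _ ≤ A * (1 + (|s| + |ε * k|) ^ (q - 2)) * (ε * k) ^ 2 := hG.abs_remainder_le s (ε * k)
    _ = ε ^ 2 * (A * (k ^ 2 + (|s| + |ε * k|) ^ (q - 2) * k ^ 2)) := by ring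
    _ ≤ _ := by gcongr

end Nonlinearity
end NKG
end

noncomputable section
namespace NKG

/-! ### Differentiability of energy and charge -/

section Functionals
variable {N : ℕ} {G g : ℝ → ℝ} {A q : ℝ}

/-- The bound of `‖v‖_{L^q}` by the `H¹` norm which the growth exponent `q` must satisfy. -/
def SobolevBound (N : ℕ) (q K : ℝ) : Prop :=
  ∀ u : H1 N, Integrable (fun x => |H1.val u x| ^ q) ∧ ∫ x, |H1.val u x| ^ q ≤ K * ‖u‖ ^ q

theorem PowerGrowth.integrable_comp (hG : PowerGrowth G g A q) {K : ℝ}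
    (hK : SobolevBound N q K) (u : H1 N) : Integrable fun x => G (H1.val u x) := by
  have hi : Integrable fun x => A * (H1.val u x ^ 2 + 2 ^ q * |H1.val u x| ^ q) :=
    ((H1.integrable_val_sq u).add ((hK u).1.const_mul _)).const_mul A
  refine hi.mono' (hG.continuous.comp_aestronglyMeasurable (H1.memLp_val u).aestronglyMeasurable) ?_
  filter_upwards with x
  have := hG.abs_remainder_scaled_le zero_le_one le_rfl 0 (H1.val u x)
  have hq := hG.two_lt
  simpa [hG.zero, hG.deriv_zero, Real.zero_rpow (by linarith : q ≠ 0)] using this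

theorem PowerGrowth.integrable_deriv_mul (hG : PowerGrowth G g A q) {K : ℝ}
    (hK : SobolevBound N q K) (u v : H1 N) :
    Integrable fun x => g (H1.val u x) * H1.val v x := by
  have hi : Integrable fun x => A * (H1.val u x ^ 2 + H1.val v x ^ 2 + |H1.val u x| ^ q +
      |H1.val v x| ^ q) :=
    ((((H1.integrable_val_sq u).add (H1.integrable_val_sq v)).add (hK u).1).add (hK v).1).const_mul
      A
  refine hi.mono' ((hG.continuous_deriv.comp_aestronglyMeasurable
    (H1.memLp_val u).aestronglyMeasurable).mul (H1.memLp_val v).aestronglyMeasurable) ?_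
  filter_upwards with x
  exact hG.abs_deriv_mul_le _ _

theorem PowerGrowth.locallyIntegrable_deriv_comp (hG : PowerGrowth G g A q) {K : ℝ}
    (hK : SobolevBound N q K) (u : H1 N) :
    LocallyIntegrable (fun x => g (H1.val u x)) volume := by
  have hi : LocallyIntegrable (fun x => A * (H1.val u x ^ 2 + 1 + |H1.val u x| ^ q + 1)) volume :=
    ((((H1.integrable_val_sq u).locallyIntegrable.add (locallyIntegrable_const 1)).add
      (hK u).1.locallyIntegrable).add (locallyIntegrable_const 1)).smul A
  refine hi.mono (hG.continuous_deriv.comp_aestronglyMeasurable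
    (H1.memLp_val u).aestronglyMeasurable) ?_
  filter_upwards with x
  have := hG.abs_deriv_mul_le (H1.val u x) 1
  simp only [mul_one, abs_one, one_pow, Real.one_rpow] at this
  exact this.trans (le_abs_self _)

theorem PowerGrowth.integral_deriv_mul_add (hG : PowerGrowth G g A q) {K : ℝ}
    (hK : SobolevBound N q K) (u v w : H1 N) :
    ∫ x, g (H1.val u x) * H1.val (v + w) x =
      (∫ x, g (H1.val u x) * H1.val v x) + ∫ x, g (H1.val u x) * H1.val w x := by
  rw [← integral_add (hG.integrable_deriv_mul hK u v) (hG.integrable_deriv_mul hK u w)]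
  refine integral_congr_ae ?_
  filter_upwards [H1.val_add v w] with x hx
  rw [hx, mul_add]

theorem integral_mul_val_smul (f : Space N → ℝ) (c : ℝ) (v : H1 N) :
    ∫ x, f x * H1.val (c • v) x = c * ∫ x, f x * H1.val v x := by
  rw [← integral_const_mul]
  refine integral_congr_ae ?_
  filter_upwards [H1.val_smul c v] with x hx
  rw [hx]
  ring

theorem PowerGrowth.exists_abs_integral_deriv_mul_le (hG : PowerGrowth G g A q) {K : ℝ}
    (hK : SobolevBound N q K) (u : H1 N) :
    ∃ C, ∀ v : H1 N, |∫ x, g (H1.val u x) * H1.val v x| ≤ C * ‖v‖ := by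
  refine ⟨A * ((∫ x, H1.val u x ^ 2) + 1 + (∫ x, |H1.val u x| ^ q) + K), fun v => ?_⟩
  have hA := hG.nonneg
  -- the pointwise bound is not homogeneous in `v`, so it is used for unit vectors only
  have hunit : ∀ w : H1 N, ‖w‖ = 1 → |∫ x, g (H1.val u x) * H1.val w x| ≤
      A * ((∫ x, H1.val u x ^ 2) + 1 + (∫ x, |H1.val u x| ^ q) + K) := by
    intro w hw
    have i1 : Integrable fun x => H1.val u x ^ 2 + H1.val w x ^ 2 :=
      (H1.integrable_val_sq u).add (H1.integrable_val_sq w)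
    have i2 : Integrable fun x => H1.val u x ^ 2 + H1.val w x ^ 2 + |H1.val u x| ^ q :=
      i1.add (hK u).1
    have i3 : Integrable fun x => H1.val u x ^ 2 + H1.val w x ^ 2 + |H1.val u x| ^ q +
        |H1.val w x| ^ q := i2.add (hK w).1
    rw [← Real.norm_eq_abs]
    refine (norm_integral_le_of_norm_le (i3.const_mul A) ?_).trans ?_
    · filter_upwards with x
      exact hG.abs_deriv_mul_le _ _
    · rw [integral_const_mul, integral_add i2 (hK w).1, integral_add i1 (hK u).1,
        integral_add (H1.integrable_val_sq u) (H1.integrable_val_sq w)]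
      have h1 := H1.integral_val_sq_le w
      have h2 := (hK w).2
      rw [hw, one_pow] at h1
      rw [hw, Real.one_rpow, mul_one] at h2
      gcongr
  rcases eq_or_ne v 0 with rfl | hv
  · have e := integral_mul_val_smul (fun x => g (H1.val u x)) 0 (0 : H1 N)
    rw [zero_smul, zero_mul] at e
    rw [e, abs_zero, norm_zero, mul_zero]
  · have hpos : 0 < ‖v‖ := norm_pos_iff.2 hv
    have h1 := hunit (‖v‖⁻¹ • v)
      (by rw [norm_smul, norm_inv, norm_norm, inv_mul_cancel₀ hpos.ne'])
    rw [integral_mul_val_smul, abs_mul, abs_of_pos (inv_pos.2 hpos),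
      inv_mul_le_iff₀ hpos] at h1
    linarith

/-- The linear functional `v ↦ ∫ g(u) v`, the derivative of `u ↦ ∫ G(u)`. -/
def PowerGrowth.derivLM (hG : PowerGrowth G g A q) {K : ℝ} (hK : SobolevBound N q K)
    (u : H1 N) : H1 N →ₗ[ℝ] ℝ where
  toFun v := ∫ x, g (H1.val u x) * H1.val v x
  map_add' v w := hG.integral_deriv_mul_add hK u v w
  map_smul' c v := integral_mul_val_smul _ c v

/-- The continuous linear functional `v ↦ ∫ g(u) v`. -/
def PowerGrowth.derivCLM (hG : PowerGrowth G g A q) {K : ℝ} (hK : SobolevBound N q K)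
    (u : H1 N) : H1 N →L[ℝ] ℝ :=
  (hG.derivLM hK u).mkContinuousOfExistsBound (hG.exists_abs_integral_deriv_mul_le hK u)

@[simp] theorem PowerGrowth.derivCLM_apply (hG : PowerGrowth G g A q) {K : ℝ}
    (hK : SobolevBound N q K) (u v : H1 N) :
    hG.derivCLM hK u v = ∫ x, g (H1.val u x) * H1.val v x := rfl

/-- The integrated Taylor remainder is quadratic in `‖h‖`: apply the scaled pointwise bound with
`ε = ‖h‖` and the unit vector `h / ‖h‖`. -/
theorem PowerGrowth.abs_integral_remainder_le (hG : PowerGrowth G g A q) {K : ℝ}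
    (hK : SobolevBound N q K) (u h : H1 N) (hh : ‖h‖ ≤ 1) :
    |(∫ x, G (H1.val (u + h) x)) - (∫ x, G (H1.val u x)) - ∫ x, g (H1.val u x) * H1.val h x| ≤
      (A * (1 + 2 ^ q * ((∫ x, |H1.val u x| ^ q) + K))) * ‖h‖ ^ 2 := by
  have hq := hG.two_lt
  rcases eq_or_ne h 0 with rfl | hne
  · have e : ∫ x, g (H1.val u x) * H1.val (0 : H1 N) x = 0 := map_zero (hG.derivCLM hK u)
    simp [e]
  have hpos : 0 < ‖h‖ := norm_pos_iff.2 hne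
  set k : H1 N := ‖h‖⁻¹ • h with hk
  have hk1 : ‖k‖ = 1 := by rw [hk, norm_smul, norm_inv, norm_norm, inv_mul_cancel₀ hpos.ne']
  have i0 : Integrable fun x => G (H1.val (u + h) x) - G (H1.val u x) :=
    (hG.integrable_comp hK _).sub (hG.integrable_comp hK _)
  rw [← integral_sub (hG.integrable_comp hK _) (hG.integrable_comp hK _),
    ← integral_sub i0 (hG.integrable_deriv_mul hK _ _), ← Real.norm_eq_abs]
  have hi : Integrable fun x => ‖h‖ ^ 2 * (A * (H1.val k x ^ 2 + 2 ^ q * (|H1.val u x| ^ q +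
      |H1.val k x| ^ q))) :=
    (((H1.integrable_val_sq k).add (((hK u).1.add (hK k).1).const_mul _)).const_mul A).const_mul _
  refine (norm_integral_le_of_norm_le hi ?_).trans ?_
  · filter_upwards [H1.val_add u h, H1.val_smul ‖h‖⁻¹ h] with x h1 h2
    have e : H1.val h x = ‖h‖ * H1.val k x := by
      rw [hk, h2, mul_inv_cancel_left₀ hpos.ne']
    rw [h1, e]
    exact hG.abs_remainder_scaled_le hpos.le hh _ _
  · have i2 : Integrable fun x => |H1.val u x| ^ q + |H1.val k x| ^ q := (hK u).1.add (hK k).1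
    rw [integral_const_mul, integral_const_mul, integral_add (H1.integrable_val_sq k)
      (i2.const_mul _), integral_const_mul, integral_add (hK u).1 (hK k).1]
    have h1 := H1.integral_val_sq_le k
    have h2 := (hK k).2
    rw [hk1, one_pow] at h1
    rw [hk1, Real.one_rpow, mul_one] at h2
    have hA := hG.nonneg
    rw [mul_comm]
    gcongr

theorem PowerGrowth.hasFDerivAt_integral (hG : PowerGrowth G g A q) {K : ℝ}
    (hK : SobolevBound N q K) (u : H1 N) :
    HasFDerivAt (fun v : H1 N => ∫ x, G (H1.val v x)) (hG.derivCLM hK u) u := by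
  rw [hasFDerivAt_iff_isLittleO_nhds_zero]
  refine Asymptotics.IsBigO.trans_isLittleO ?_ (Asymptotics.isLittleO_norm_pow_id one_lt_two)
  refine Asymptotics.IsBigO.of_bound (A * (1 + 2 ^ q * ((∫ x, |H1.val u x| ^ q) + K))) ?_
  filter_upwards [Metric.closedBall_mem_nhds (0 : H1 N) one_pos] with h hh
  rw [mem_closedBall_zero_iff] at hh
  rw [norm_pow, norm_norm]
  exact hG.abs_integral_remainder_le hK u h hh

theorem potential_ofReal (F : ℝ → ℝ) (s : ℝ) : potential F (s : ℂ) = realPotential F s := by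
  rw [potential, Complex.norm_real, realPotential, Real.norm_eq_abs]

theorem energy_eq (F : ℝ → ℝ) (p : H1 N × ℝ)
    (hi : Integrable fun x => realPotential F (H1.val p.1 x)) :
    energy F p = 1 / 2 * ‖H1.gradL2 N p.1‖ ^ 2 + 1 / 2 * p.2 ^ 2 * ‖H1.toL2 N p.1‖ ^ 2
      + ∫ x, realPotential F (H1.val p.1 x) := by
  obtain ⟨u, ω⟩ := p
  have i1 : Integrable fun x => 1 / 2 * ‖H1.grad u x‖ ^ 2 :=
    ((H1.memLp_grad u).integrable_norm_pow two_ne_zero).const_mul _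
  have i2 : Integrable fun x => 1 / 2 * ω ^ 2 * H1.val u x ^ 2 :=
    (H1.integrable_val_sq u).const_mul _
  have i12 : Integrable fun x => 1 / 2 * ‖H1.grad u x‖ ^ 2 + 1 / 2 * ω ^ 2 * H1.val u x ^ 2 :=
    i1.add i2
  have e1 := H1.norm_gradL2_sq u
  have e2 := H1.norm_toL2_sq u
  simp only [energy, potential_ofReal]
  simp only at hi
  rw [integral_add i12 hi, integral_add i1 i2, integral_const_mul,
    integral_const_mul, e1, e2]

theorem charge_eq (p : H1 N × ℝ) : charge p = -(p.2 * ‖H1.toL2 N p.1‖ ^ 2) := by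
  unfold charge
  rw [integral_const_mul, H1.norm_toL2_sq]

section Abstract

variable {E E₁ E₂ : Type*} [NormedAddCommGroup E] [NormedSpace ℝ E]
  [NormedAddCommGroup E₁] [InnerProductSpace ℝ E₁] [NormedAddCommGroup E₂] [InnerProductSpace ℝ E₂]

/-- The derivative at `(u, ω)` of `½‖L₁ u‖² + ½ω²‖L₂ u‖² + Φ(u)`, where `D = Φ'(u)`. -/
def energyDeriv (L₁ : E →L[ℝ] E₁) (L₂ : E →L[ℝ] E₂) (D : E →L[ℝ] ℝ) (u : E) (ω : ℝ) :
    E × ℝ →L[ℝ] ℝ :=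
  ((innerSL ℝ (L₁ u)).comp L₁ + (ω ^ 2) • (innerSL ℝ (L₂ u)).comp L₂ + D).comp
    (ContinuousLinearMap.fst ℝ _ _) + (ω * ‖L₂ u‖ ^ 2) • ContinuousLinearMap.snd ℝ _ _

/-- The derivative at `(u, ω)` of `-ω‖L u‖²`. -/
def chargeDeriv (L : E →L[ℝ] E₁) (u : E) (ω : ℝ) : E × ℝ →L[ℝ] ℝ :=
  (-(2 * ω)) • ((innerSL ℝ (L u)).comp L).comp (ContinuousLinearMap.fst ℝ _ _) -
    (‖L u‖ ^ 2) • ContinuousLinearMap.snd ℝ _ _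

theorem energyDeriv_apply (L₁ : E →L[ℝ] E₁) (L₂ : E →L[ℝ] E₂) (D : E →L[ℝ] ℝ) (u v : E)
    (ω τ : ℝ) : energyDeriv L₁ L₂ D u ω (v, τ) = inner ℝ (L₁ u) (L₁ v) +
      ω ^ 2 * inner ℝ (L₂ u) (L₂ v) + D v + ω * ‖L₂ u‖ ^ 2 * τ := by
  simp [energyDeriv]

theorem chargeDeriv_apply (L : E →L[ℝ] E₁) (u v : E) (ω τ : ℝ) :
    chargeDeriv L u ω (v, τ) = -(2 * ω) * inner ℝ (L u) (L v) - ‖L u‖ ^ 2 * τ := by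
  simp [chargeDeriv]

theorem hasFDerivAt_norm_sq_comp_fst (L : E →L[ℝ] E₁) (p : E × ℝ) :
    HasFDerivAt (fun p : E × ℝ => ‖L p.1‖ ^ 2)
      ((2 : ℝ) • ((innerSL ℝ (L p.1)).comp L).comp (ContinuousLinearMap.fst ℝ _ _)) p := by
  have h := (L.comp (ContinuousLinearMap.fst ℝ E ℝ)).hasFDerivAt (x := p)
  refine h.norm_sq.congr_fderiv ?_
  ext <;> simp

theorem hasFDerivAt_chargeDeriv (L : E →L[ℝ] E₁) (u : E) (ω : ℝ) :
    HasFDerivAt (fun p : E × ℝ => -(p.2 * ‖L p.1‖ ^ 2)) (chargeDeriv L u ω) (u, ω) := by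
  have h1 := hasFDerivAt_norm_sq_comp_fst L (u, ω)
  have h2 := (hasFDerivAt_snd (𝕜 := ℝ) (p := (u, ω))).mul h1
  refine h2.neg.congr_fderiv ?_
  refine ContinuousLinearMap.ext fun x => ?_
  obtain ⟨v, τ⟩ := x
  rw [chargeDeriv_apply]
  simp
  ring

theorem hasFDerivAt_energyDeriv (L₁ : E →L[ℝ] E₁) (L₂ : E →L[ℝ] E₂) {Φ : E → ℝ}
    {D : E →L[ℝ] ℝ} {u : E} (hΦ : HasFDerivAt Φ D u) (ω : ℝ) :
    HasFDerivAt (fun p : E × ℝ => 1 / 2 * ‖L₁ p.1‖ ^ 2 + 1 / 2 * p.2 ^ 2 * ‖L₂ p.1‖ ^ 2 + Φ p.1)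
      (energyDeriv L₁ L₂ D u ω) (u, ω) := by
  have h1 := (hasFDerivAt_norm_sq_comp_fst L₁ (u, ω)).const_mul (1 / 2)
  have h2 := hasFDerivAt_norm_sq_comp_fst L₂ (u, ω)
  have h3 := (((hasFDerivAt_snd (𝕜 := ℝ) (p := (u, ω))).pow 2).const_mul (1 / 2)).mul h2
  have h4 : HasFDerivAt (fun p : E × ℝ => Φ p.1) (D.comp (ContinuousLinearMap.fst ℝ E ℝ)) (u, ω) :=
    HasFDerivAt.comp (u, ω) hΦ (hasFDerivAt_fst (𝕜 := ℝ) (p := (u, ω)))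
  refine ((h1.add h3).add h4).congr_fderiv ?_
  refine ContinuousLinearMap.ext fun x => ?_
  obtain ⟨v, τ⟩ := x
  rw [energyDeriv_apply]
  simp
  ring

end Abstract

theorem hasFDerivAt_charge (u : H1 N) (ω : ℝ) :
    HasFDerivAt (charge : H1 N × ℝ → ℝ) (chargeDeriv (H1.toL2 N) u ω) (u, ω) := by
  have e : (charge : H1 N × ℝ → ℝ) = fun p => -(p.2 * ‖H1.toL2 N p.1‖ ^ 2) := funext charge_eq
  rw [e]
  exact hasFDerivAt_chargeDeriv _ u ω

theorem hasFDerivAt_energy {F : ℝ → ℝ} {K : ℝ}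
    (hG : PowerGrowth (realPotential F) (realPotentialDeriv F) A q) (hK : SobolevBound N q K)
    (u : H1 N) (ω : ℝ) :
    HasFDerivAt (energy F)
      (energyDeriv (H1.gradL2 N) (H1.toL2 N) (hG.derivCLM hK u) u ω) (u, ω) := by
  have e : energy F = fun p : H1 N × ℝ => 1 / 2 * ‖H1.gradL2 N p.1‖ ^ 2 +
      1 / 2 * p.2 ^ 2 * ‖H1.toL2 N p.1‖ ^ 2 + ∫ x, realPotential F (H1.val p.1 x) :=
    funext fun p => energy_eq F p (hG.integrable_comp hK p.1)
  rw [e]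
  exact hasFDerivAt_energyDeriv _ _ (hG.hasFDerivAt_integral hK u) ω

end Functionals
end NKG
end

noncomputable section
namespace NKG

/-! ### Separation of variables in the Klein–Gordon equation -/

section Wave
variable {N : ℕ}

/-- The phase factor `e^{-iωt}`. -/
def phase (ω t : ℝ) : ℂ := Complex.exp (-Complex.I * ω * t)

theorem norm_phase (ω t : ℝ) : ‖phase ω t‖ = 1 := by
  rw [phase, show -Complex.I * ω * t = ((-(ω * t) : ℝ) : ℂ) * Complex.I by push_cast; ring]
  exact Complex.norm_exp_ofReal_mul_I _

theorem phase_mul_exp (ω t : ℝ) : phase ω t * Complex.exp (Complex.I * ω * t) = 1 := by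
  rw [phase, ← Complex.exp_add]
  simp

theorem hasDerivAt_phase (ω t : ℝ) : HasDerivAt (phase ω) (-Complex.I * ω * phase ω t) t := by
  have h : HasDerivAt (fun s : ℝ => -Complex.I * ω * (s : ℂ)) (-Complex.I * ω * 1) t :=
    (Complex.ofRealCLM.hasDerivAt (x := t)).const_mul _
  have := h.cexp
  rw [mul_one] at this
  exact this.congr_deriv (mul_comm _ _)

theorem contDiff_phase (ω : ℝ) : ContDiff ℝ (⊤ : ℕ∞) (phase ω) := by
  unfold phase
  exact (contDiff_const.mul Complex.ofRealCLM.contDiff).cexp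

theorem deriv_eq_dirDeriv (θ : ℝ → ℂ) : deriv θ = dirDeriv 1 θ := by
  ext t
  exact fderiv_apply_one_eq_deriv.symm

theorem iteratedDeriv_two_eq_dirDeriv (θ : ℝ → ℂ) :
    iteratedDeriv 2 θ = dirDeriv 1 (dirDeriv 1 θ) := by
  rw [iteratedDeriv_succ, iteratedDeriv_one, deriv_eq_dirDeriv, deriv_eq_dirDeriv]

/-- The phase is a solution of the harmonic oscillator equation: integrating by parts twice, it
annihilates `θ'' + ω² θ`, which equals `e^{iωt} ((θ' + iωθ) e^{-iωt})'`. -/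
theorem integral_phase_mul_eq_zero (ω : ℝ) {θ : ℝ → ℂ} (h : IsTest θ) :
    ∫ t, phase ω t * (iteratedDeriv 2 θ t + ω ^ 2 * θ t) = 0 := by
  have hd : ∀ η : ℝ → ℂ, IsTest η → ∀ t, HasDerivAt η (dirDeriv 1 η t) t := fun η hη t => by
    rw [← deriv_eq_dirDeriv]
    exact (hη.differentiable t).hasDerivAt
  have h1 := h.dirDeriv 1
  have h2 := h1.dirDeriv 1
  have hp : LocallyIntegrable (phase ω) volume := (contDiff_phase ω).continuous.locallyIntegrable
  rw [iteratedDeriv_two_eq_dirDeriv]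
  have ht1 : IsTest fun t => ((ω : ℂ) ^ 2) * θ t :=
    ⟨contDiff_const.mul h.contDiff, h.hasCompactSupport.mul_left⟩
  have ht2 : IsTest fun t => (Complex.I * ω) * θ t :=
    ⟨contDiff_const.mul h.contDiff, h.hasCompactSupport.mul_left⟩
  refine integral_eq_zero_of_hasDerivAt_of_integrable
    (f := fun t => phase ω t * (dirDeriv 1 θ t + Complex.I * ω * θ t)) (fun t => ?_)
    ((h2.add ht1).integrable_mul hp) ((h1.add ht2).integrable_mul hp)
  refine ((hasDerivAt_phase ω t).mul
    ((hd _ h1 t).add ((hd _ h t).const_mul (Complex.I * ω)))).congr_deriv ?_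
  have := Complex.I_sq
  simp only [Pi.add_apply]
  linear_combination (-(ω : ℂ) ^ 2 * phase ω t * θ t) * this

theorem IsTest.slice_right {φ : ℝ × Space N → ℂ} (h : IsTest φ) (t : ℝ) :
    IsTest fun x => φ (t, x) where
  contDiff := h.contDiff.comp (contDiff_const.prodMk contDiff_id)
  hasCompactSupport := HasCompactSupport.intro (h.hasCompactSupport.isCompact.image continuous_snd)
    fun _ hx => image_eq_zero_of_notMem_tsupport fun hm => hx ⟨_, hm, rfl⟩

theorem IsTest.slice_left {φ : ℝ × Space N → ℂ} (h : IsTest φ) (x : Space N) :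
    IsTest fun t => φ (t, x) where
  contDiff := h.contDiff.comp (contDiff_id.prodMk contDiff_const)
  hasCompactSupport := HasCompactSupport.intro (h.hasCompactSupport.isCompact.image continuous_fst)
    fun _ ht => image_eq_zero_of_notMem_tsupport fun hm => ht ⟨_, hm, rfl⟩

theorem dirDeriv_slice_left {φ : ℝ × Space N → ℂ} (h : IsTest φ) (x : Space N) :
    dirDeriv 1 (fun t => φ (t, x)) = fun t => dirDeriv ((1 : ℝ), (0 : Space N)) φ (t, x) := by
  ext t
  have : HasFDerivAt (fun s : ℝ => (s, x)) (ContinuousLinearMap.inl ℝ ℝ (Space N)) t :=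
    hasFDerivAt_prodMk_left t x
  exact congrArg (fun L => L (1 : ℝ))
    (((h.differentiable (t, x)).hasFDerivAt.comp t this).fderiv)

theorem dirDeriv_slice_right {φ : ℝ × Space N → ℂ} (h : IsTest φ) (t : ℝ) (v : Space N) :
    dirDeriv v (fun x => φ (t, x)) = fun x => dirDeriv ((0 : ℝ), v) φ (t, x) := by
  ext x
  have : HasFDerivAt (fun y : Space N => (t, y)) (ContinuousLinearMap.inr ℝ ℝ (Space N)) x :=
    hasFDerivAt_prodMk_right t x
  exact congrArg (fun L => L v) (((h.differentiable (t, x)).hasFDerivAt.comp x this).fderiv)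

theorem isTest_timeDeriv {φ : ℝ × Space N → ℂ} (h : IsTest φ) :
    IsTest fun z : ℝ × Space N => iteratedDeriv 2 (fun s => φ (s, z.2)) z.1 := by
  have e : (fun z : ℝ × Space N => iteratedDeriv 2 (fun s => φ (s, z.2)) z.1) =
      dirDeriv ((1 : ℝ), (0 : Space N)) (dirDeriv ((1 : ℝ), (0 : Space N)) φ) := by
    ext z
    rw [iteratedDeriv_two_eq_dirDeriv, dirDeriv_slice_left h, dirDeriv_slice_left (h.dirDeriv _)]
  rw [e]
  exact (h.dirDeriv _).dirDeriv _

theorem isTest_spaceLaplacian {φ : ℝ × Space N → ℂ} (h : IsTest φ) :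
    IsTest fun z : ℝ × Space N => Laplacian.laplacian (fun y => φ (z.1, y)) z.2 := by
  have e : (fun z : ℝ × Space N => Laplacian.laplacian (fun y => φ (z.1, y)) z.2) = fun z =>
      ∑ i, dirDeriv ((0 : ℝ), stdVec N i) (dirDeriv ((0 : ℝ), stdVec N i) φ) z := by
    ext z
    rw [laplacian_eq_sum_dirDeriv ((h.slice_right z.1).contDiff.of_le (by norm_cast))]
    refine Finset.sum_congr rfl fun i _ => ?_
    rw [dirDeriv_slice_right h, dirDeriv_slice_right (h.dirDeriv _)]
  rw [e]
  exact IsTest.sum fun i => (h.dirDeriv _).dirDeriv _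

theorem locallyIntegrable_mul_prod {a : ℝ → ℂ} {b : Space N → ℂ} (ha : LocallyIntegrable a volume)
    (hb : LocallyIntegrable b volume) :
    LocallyIntegrable (fun z : ℝ × Space N => a z.1 * b z.2) volume := by
  rw [locallyIntegrable_iff] at *
  intro k hk
  have h1 := ha _ (hk.image continuous_fst)
  have h2 := hb _ (hk.image continuous_snd)
  have h3 := Integrable.mul_prod h1 h2
  rw [Measure.prod_restrict] at h3
  refine IntegrableOn.mono_set (t := (Prod.fst '' k) ×ˢ (Prod.snd '' k)) h3 ?_
  exact fun z hz => ⟨⟨z, hz, rfl⟩, ⟨z, hz, rfl⟩⟩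

/-- The equation `-Δu + f = ω² u` in the sense of distributions on `ℝ^N`. -/
def IsWeakStationary (u f : Space N → ℝ) (ω : ℝ) : Prop :=
  ∀ φ : Space N → ℝ, IsTest φ →
    ∫ x, (u x * (-ω ^ 2 * φ x - Laplacian.laplacian φ x) + f x * φ x) = 0

theorem LocallyIntegrable.ofReal {f : Space N → ℝ} (hf : LocallyIntegrable f volume) :
    LocallyIntegrable (fun x => (f x : ℂ)) volume := fun x =>
  let ⟨s, hs, hi⟩ := hf x
  ⟨s, hs, hi.ofReal⟩

variable {u f : Space N → ℝ} {ω : ℝ}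

/-- The integrand of the stationary equation against a complex test function is integrable. -/
theorem integrable_stationary (hu : LocallyIntegrable u volume) (hf : LocallyIntegrable f volume)
    (ω : ℝ) {χ : Space N → ℂ} (h : IsTest χ) : Integrable fun x =>
      (u x : ℂ) * (-ω ^ 2 * χ x - Laplacian.laplacian χ x) + f x * χ x := by
  have ht : IsTest fun x => -(ω : ℂ) ^ 2 * χ x - Laplacian.laplacian χ x :=
    ⟨(contDiff_const.mul h.contDiff).sub h.laplacian.contDiff,
      h.hasCompactSupport.mul_left.sub h.laplacian.hasCompactSupport⟩
  exact (ht.integrable_mul (LocallyIntegrable.ofReal hu)).add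
    (h.integrable_mul (LocallyIntegrable.ofReal hf))

theorem IsWeakStationary.complex (h : IsWeakStationary u f ω) (hu : LocallyIntegrable u volume)
    (hf : LocallyIntegrable f volume) {χ : Space N → ℂ} (hχ : IsTest χ) :
    ∫ x, ((u x : ℂ) * (-ω ^ 2 * χ x - Laplacian.laplacian χ x) + f x * χ x) = 0 := by
  have hi := integrable_stationary hu hf ω hχ
  have hΔ : ∀ (L : ℂ →L[ℝ] ℝ) x, Laplacian.laplacian (fun y => L (χ y)) x =
      L (Laplacian.laplacian χ x) := fun L x =>
    (hχ.contDiff.contDiffAt.of_le (by norm_cast)).laplacian_CLM_comp_left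
  apply Complex.ext
  · have := h _ (hχ.clm_comp Complex.reCLM)
    rw [Complex.zero_re, ← this]
    refine (integral_re hi).symm.trans (integral_congr_ae ?_)
    filter_upwards with x
    rw [hΔ]
    simp [← Complex.ofReal_pow]
  · have := h _ (hχ.clm_comp Complex.imCLM)
    rw [Complex.zero_im, ← this]
    refine (integral_im hi).symm.trans (integral_congr_ae ?_)
    filter_upwards with x
    rw [hΔ]
    simp [← Complex.ofReal_pow]

/-- A distributional solution `u` of the stationary equation gives the solution `u e^{-iωt}` of
the wave equation: at each fixed time the stationary equation replaces `-Δu + f` by `ω² u`, and the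
remaining operator `∂ₜ² + ω²` annihilates `e^{-iωt}`; Fubini's theorem permits the two steps. -/
theorem IsWeakStationary.wave (h : IsWeakStationary u f ω) (hu : LocallyIntegrable u volume)
    (hf : LocallyIntegrable f volume) {φ : ℝ × Space N → ℂ} (hφ : IsTest φ) :
    ∫ z : ℝ × Space N, ((u z.2 * phase ω z.1) * (iteratedDeriv 2 (fun s => φ (s, z.2)) z.1
          - Laplacian.laplacian (fun y => φ (z.1, y)) z.2) + (f z.2 * phase ω z.1) * φ z) = 0 := by
  have hp : LocallyIntegrable (phase ω) volume := (contDiff_phase ω).continuous.locallyIntegrable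
  have hpu := locallyIntegrable_mul_prod hp (LocallyIntegrable.ofReal hu)
  have hpf := locallyIntegrable_mul_prod hp (LocallyIntegrable.ofReal hf)
  have hφ' : ∀ c : ℂ, IsTest fun z => c * φ z := fun c =>
    ⟨contDiff_const.mul hφ.contDiff, hφ.hasCompactSupport.mul_left⟩
  have ht := isTest_timeDeriv hφ
  have hΔ := isTest_spaceLaplacian hφ
  let A : ℝ × Space N → ℂ := fun z => (phase ω z.1 * u z.2) *
    (iteratedDeriv 2 (fun s => φ (s, z.2)) z.1 + ω ^ 2 * φ z)
  let B : ℝ × Space N → ℂ := fun z => (phase ω z.1 * u z.2) *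
    (-ω ^ 2 * φ z - Laplacian.laplacian (fun y => φ (z.1, y)) z.2) + (phase ω z.1 * f z.2) * φ z
  have hA : Integrable A (volume.prod volume) := (ht.add (hφ' _)).integrable_mul hpu
  have hB : Integrable B (volume.prod volume) := by
    have ht2 : IsTest fun z : ℝ × Space N => -(ω : ℂ) ^ 2 * φ z -
        Laplacian.laplacian (fun y => φ (z.1, y)) z.2 :=
      ⟨(hφ' _).contDiff.sub hΔ.contDiff, (hφ' _).hasCompactSupport.sub hΔ.hasCompactSupport⟩
    exact (ht2.integrable_mul hpu).add (hφ.integrable_mul hpf)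
  have e : ∀ z : ℝ × Space N, (u z.2 * phase ω z.1) * (iteratedDeriv 2 (fun s => φ (s, z.2)) z.1
      - Laplacian.laplacian (fun y => φ (z.1, y)) z.2) + (f z.2 * phase ω z.1) * φ z =
      A z + B z := fun z => by
    simp only [A, B]
    ring
  simp only [e]
  rw [Measure.volume_eq_prod, integral_add hA hB, integral_prod_symm A hA, integral_prod B hB]
  have hA0 : ∀ x, ∫ t, A (t, x) = 0 := fun x => by
    have e : ∀ t, A (t, x) = u x * (phase ω t * (iteratedDeriv 2 (fun s => φ (s, x)) t +
        ω ^ 2 * φ (t, x))) := fun t => by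
      simp only [A]
      ring
    simp only [e]
    rw [integral_const_mul, integral_phase_mul_eq_zero ω (hφ.slice_left x), mul_zero]
  have hB0 : ∀ t, ∫ x, B (t, x) = 0 := fun t => by
    have e : ∀ x, B (t, x) = phase ω t * (u x * (-ω ^ 2 * φ (t, x) -
        Laplacian.laplacian (fun y => φ (t, y)) x) + f x * φ (t, x)) := fun x => by
      simp only [B]
      ring
    simp only [e]
    rw [integral_const_mul, h.complex hu hf (hφ.slice_right t), mul_zero]
  simp [hA0, hB0]

/-- Conversely, testing the wave equation with `η(t) e^{iωt} χ(x)`, where `∫ η ≠ 0`, recovers the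
stationary equation. -/
theorem isWeakStationary_of_wave (hu : LocallyIntegrable u volume)
    (hf : LocallyIntegrable f volume) (h : ∀ φ : ℝ × Space N → ℂ, IsTest φ →
      ∫ z : ℝ × Space N, ((u z.2 * phase ω z.1) * (iteratedDeriv 2 (fun s => φ (s, z.2)) z.1
        - Laplacian.laplacian (fun y => φ (z.1, y)) z.2) + (f z.2 * phase ω z.1) * φ z) = 0) :
    IsWeakStationary u f ω := by
  intro χ hχ
  let η : ContDiffBump (0 : ℝ) := ⟨1, 2, one_pos, one_lt_two⟩
  let θ : ℝ → ℂ := fun t => (η t : ℂ) * Complex.exp (Complex.I * ω * t)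
  have hηc : IsTest fun t => (η t : ℂ) :=
    (IsTest.mk η.contDiff η.hasCompactSupport).clm_comp Complex.ofRealCLM
  have hθ : IsTest θ :=
    ⟨hηc.contDiff.mul (contDiff_const.mul Complex.ofRealCLM.contDiff).cexp,
      hηc.hasCompactSupport.mul_right⟩
  have hχc : IsTest fun x => (χ x : ℂ) := hχ.clm_comp Complex.ofRealCLM
  have hφ : IsTest fun z : ℝ × Space N => θ z.1 * (χ z.2 : ℂ) := by
    refine ⟨(hθ.contDiff.comp contDiff_fst).mul (hχc.contDiff.comp contDiff_snd),
      HasCompactSupport.intro (hθ.hasCompactSupport.isCompact.prod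
        hχc.hasCompactSupport.isCompact) fun z hz => ?_⟩
    by_cases h1 : z.1 ∈ tsupport θ
    · rw [image_eq_zero_of_notMem_tsupport (f := fun x => (χ x : ℂ)) fun h2 => hz ⟨h1, h2⟩,
        mul_zero]
    · rw [image_eq_zero_of_notMem_tsupport h1, zero_mul]
  have hpθ : ∀ t, phase ω t * θ t = η t := fun t => by
    rw [mul_left_comm, phase_mul_exp, mul_one]
  have hΔ : ∀ c : ℂ, ∀ x, Laplacian.laplacian (fun y => c * (χ y : ℂ)) x =
      c * (Laplacian.laplacian χ x : ℝ) := fun c x =>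
    (hχ.contDiff.contDiffAt.of_le (by norm_cast)).laplacian_CLM_comp_left
      (l := c • Complex.ofRealCLM)
  have hp : LocallyIntegrable (phase ω) volume := (contDiff_phase ω).continuous.locallyIntegrable
  have hθ2 : IsTest (iteratedDeriv 2 θ) := by
    rw [iteratedDeriv_two_eq_dirDeriv]
    exact (hθ.dirDeriv _).dirDeriv _
  have i1 : Integrable fun t => phase ω t * iteratedDeriv 2 θ t := hθ2.integrable_mul hp
  have i2 : Integrable fun t => phase ω t * θ t := hθ.integrable_mul hp
  have j1 : Integrable fun x => u x * χ x :=
    (hχ.integrable_smul hu).congr (by filter_upwards with x using mul_comm _ _)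
  have j2 : Integrable fun x => u x * -Laplacian.laplacian χ x + f x * χ x := by
    refine Integrable.add ?_ ?_
    · refine (hχ.laplacian.integrable_smul hu).neg.congr ?_
      filter_upwards with x
      simp [mul_comm]
    · exact (hχ.integrable_smul hf).congr (by filter_upwards with x using mul_comm _ _)
  have key := h _ hφ
  have e : ∀ z : ℝ × Space N, (u z.2 * phase ω z.1) *
      (iteratedDeriv 2 (fun s => θ s * (χ z.2 : ℂ)) z.1
        - Laplacian.laplacian (fun y => θ z.1 * (χ y : ℂ)) z.2) +
        (f z.2 * phase ω z.1) * (θ z.1 * (χ z.2 : ℂ)) =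
      (phase ω z.1 * iteratedDeriv 2 θ z.1) * ((u z.2 * χ z.2 : ℝ) : ℂ) +
      (phase ω z.1 * θ z.1) *
        ((u z.2 * -Laplacian.laplacian χ z.2 + f z.2 * χ z.2 : ℝ) : ℂ) := fun z => by
    rw [hΔ, iteratedDeriv_mul_const_field]
    push_cast
    ring
  simp only [e] at key
  have k1 : Integrable (fun z : ℝ × Space N =>
      (phase ω z.1 * iteratedDeriv 2 θ z.1) * ((u z.2 * χ z.2 : ℝ) : ℂ)) (volume.prod volume) :=
    Integrable.mul_prod i1 j1.ofReal
  have k2 : Integrable (fun z : ℝ × Space N => (phase ω z.1 * θ z.1) *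
      ((u z.2 * -Laplacian.laplacian χ z.2 + f z.2 * χ z.2 : ℝ) : ℂ)) (volume.prod volume) :=
    Integrable.mul_prod i2 j2.ofReal
  rw [Measure.volume_eq_prod, integral_add k1 k2,
    integral_prod_mul (fun t => phase ω t * iteratedDeriv 2 θ t) fun x => ((u x * χ x : ℝ) : ℂ),
    integral_prod_mul (fun t => phase ω t * θ t) fun x =>
      ((u x * -Laplacian.laplacian χ x + f x * χ x : ℝ) : ℂ)] at key
  have h1 := integral_phase_mul_eq_zero ω hθ
  simp only [mul_add, mul_left_comm (phase ω _) ((ω : ℂ) ^ 2)] at h1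
  rw [integral_add i1 (i2.const_mul _), integral_const_mul] at h1
  rw [eq_neg_of_add_eq_zero_left h1] at key
  simp only [hpθ] at key
  rw [integral_complex_ofReal, integral_complex_ofReal, integral_complex_ofReal] at key
  norm_cast at key
  have e2 : ∫ x, (u x * (-ω ^ 2 * χ x - Laplacian.laplacian χ x) + f x * χ x) =
      -ω ^ 2 * (∫ x, u x * χ x) + ∫ x, (u x * -Laplacian.laplacian χ x + f x * χ x) := by
    rw [← integral_const_mul, ← integral_add (j1.const_mul _) j2]
    congr 1
    ext x
    ring
  have hη : (∫ t, η t) ≠ 0 := η.integral_pos.ne'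
  refine (mul_eq_zero.1 ?_).resolve_left hη
  rw [e2]
  linear_combination key

end Wave
end NKG
end

noncomputable section
namespace NKG

/-! ### Standing waves -/

section StandingWave
variable {N : ℕ} {F : ℝ → ℝ} {A q K : ℝ}

theorem HasWeakPartial.clm_comp {V W : Type*} [NormedAddCommGroup V] [NormedSpace ℝ V]
    [NormedAddCommGroup W] [NormedSpace ℝ W] [CompleteSpace V] [CompleteSpace W]
    {i : Fin N} {u g : Space N → V} (h : HasWeakPartial i u g) (L : V →L[ℝ] W) :
    HasWeakPartial i (fun x => L (u x)) (fun x => L (g x)) where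
  locallyIntegrable x :=
    let ⟨s, hs, hi⟩ := h.locallyIntegrable x
    ⟨s, hs, L.integrable_comp hi⟩
  locallyIntegrable_deriv x :=
    let ⟨s, hs, hi⟩ := h.locallyIntegrable_deriv x
    ⟨s, hs, L.integrable_comp hi⟩
  integral_eq φ hφ hc := by
    have h' : IsTest φ := ⟨hφ, hc⟩
    simp only [← map_smul]
    have j : Integrable fun x => fderiv ℝ φ x (EuclideanSpace.single i 1) • u x :=
      (h'.dirDeriv _).integrable_smul h.locallyIntegrable
    rw [L.integral_comp_comm j,
      L.integral_comp_comm (h'.integrable_smul h.locallyIntegrable_deriv),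
      h.integral_eq φ hφ hc, map_neg]

theorem standingWave_eq (u : H1 N) (ω t : ℝ) (x : Space N) :
    standingWave u ω t x = H1.val u x * phase ω t := rfl

theorem potential_standingWave (F : ℝ → ℝ) (u : H1 N) (ω t : ℝ) (x : Space N) :
    potential F (standingWave u ω t x) = realPotential F (H1.val u x) := by
  rw [potential, standingWave_eq, norm_mul, norm_phase, mul_one, Complex.norm_real,
    Real.norm_eq_abs, realPotential]

theorem potentialDeriv_standingWave (F : ℝ → ℝ) (u : H1 N) (ω t : ℝ) (x : Space N) :
    potentialDeriv F (standingWave u ω t x) =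
      (realPotentialDeriv F (H1.val u x) : ℂ) * phase ω t := by
  rw [potentialDeriv, standingWave_eq, norm_mul, norm_phase, mul_one, Complex.norm_real,
    Real.norm_eq_abs, realPotentialDeriv]
  push_cast
  ring

/-- A standing wave with profile in `H¹` has finite energy at all times. -/
theorem hasFiniteEnergy_standingWave
    (hG : PowerGrowth (realPotential F) (realPotentialDeriv F) A q) (hK : SobolevBound N q K)
    (u : H1 N) (ω : ℝ) : HasFiniteEnergy F (standingWave u ω) := by
  intro t
  have hd : ∀ x, HasDerivAt (fun s => standingWave u ω s x)
      (H1.val u x * (-Complex.I * ω * phase ω t)) t := fun x =>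
    (hasDerivAt_phase ω t).const_mul _
  have hm : ∀ c : ℂ, MemLp (fun x => (H1.val u x : ℂ) * c) 2 volume := fun c =>
    (ContinuousLinearMap.toSpanSingleton ℝ c).comp_memLp' (H1.memLp_val u)
  refine ⟨hm _, fun i => ⟨fun x => (H1.grad u x i : ℂ) * phase ω t, ?_, ?_⟩,
    fun x => (hd x).differentiableAt, ?_, ?_⟩
  · exact (ContinuousLinearMap.toSpanSingleton ℝ (phase ω t)).comp_memLp'
      (H1.memLp_grad_apply u i)
  · exact (H1.hasWeakPartial u i).clm_comp (ContinuousLinearMap.toSpanSingleton ℝ (phase ω t))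
  · simp only [fun x => (hd x).deriv]
    exact hm _
  · simp only [potential_standingWave]
    exact hG.integrable_comp hK u

theorem isSolution_standingWave_iff
    (hG : PowerGrowth (realPotential F) (realPotentialDeriv F) A q) (hK : SobolevBound N q K)
    (u : H1 N) (ω : ℝ) : IsSolution F (standingWave u ω) ↔
      IsWeakStationary (H1.val u) (fun x => realPotentialDeriv F (H1.val u x)) ω := by
  have hu : LocallyIntegrable (H1.val u) volume := (H1.memLp_val u).locallyIntegrable one_le_two
  have hf := hG.locallyIntegrable_deriv_comp hK u
  have hp : LocallyIntegrable (phase ω) volume := (contDiff_phase ω).continuous.locallyIntegrable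
  constructor
  · intro h
    refine isWeakStationary_of_wave hu hf fun φ hφ => ?_
    have := h.integral_eq_zero φ hφ.contDiff hφ.hasCompactSupport
    simp only [potentialDeriv_standingWave] at this
    simpa only [standingWave_eq] using this
  · intro h
    refine ⟨?_, ?_, fun φ hφ hc => ?_⟩
    · have := locallyIntegrable_mul_prod hp (LocallyIntegrable.ofReal hu)
      simpa only [standingWave_eq, mul_comm] using this
    · have := locallyIntegrable_mul_prod hp (LocallyIntegrable.ofReal hf)
      simpa only [potentialDeriv_standingWave, mul_comm] using this
    · have := h.wave hu hf (φ := φ) ⟨hφ, hc⟩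
      simp only [potentialDeriv_standingWave]
      simpa only [standingWave_eq] using this

end StandingWave

/-! ### Constrained critical points -/

section Critical

/-- A point where the derivative of `f` is a multiple of that of `c` is a critical point of `f`
on the level set of `c`. -/
theorem isConstrainedCriticalPoint_of_eq_smul {B : Type*} [NormedAddCommGroup B] [NormedSpace ℝ B]
    {f c : B → ℝ} {f' c' : B →L[ℝ] ℝ} {x : B} {r : ℝ} (hf : HasFDerivAt f f' x)
    (hc : HasFDerivAt c c' x) (h : f' = r • c') :
    IsConstrainedCriticalPoint f {p | c p = c x} x := by
  refine ⟨rfl, fun γ h0 hγ hd => ?_⟩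
  have hd' := hd.hasDerivAt
  have h1 : HasDerivAt (fun s => f (γ s)) (f' (deriv γ 0)) 0 :=
    HasFDerivAt.comp_hasDerivAt (f := γ) 0 (by rwa [h0]) hd'
  have h2 : HasDerivAt (fun s => c (γ s)) (c' (deriv γ 0)) 0 :=
    HasFDerivAt.comp_hasDerivAt (f := γ) 0 (by rwa [h0]) hd'
  have h3 : (fun s => c (γ s)) =ᶠ[𝓝 0] fun _ => c x := hγ
  have h4 : c' (deriv γ 0) = 0 := by
    rw [← h2.deriv, h3.deriv_eq, deriv_const]
  have h5 : f' (deriv γ 0) = 0 := by rw [h, smul_apply, h4, smul_zero]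
  rwa [h5] at h1

theorem fderiv_eq_smul_fderiv_iff {B : Type*} [NormedAddCommGroup B] [NormedSpace ℝ B]
    {f c : B → ℝ} {f' c' : B →L[ℝ] ℝ} {x : B} {r μ : ℝ} (hf : HasFDerivAt f f' x)
    (hc : HasFDerivAt c c' x) (hne : c' ≠ 0) (h : f' = r • c') :
    fderiv ℝ f x = μ • fderiv ℝ c x ↔ μ = r := by
  rw [hf.fderiv, hc.fderiv, h, (smul_left_injective ℝ hne).eq_iff]
  exact eq_comm

variable {E E₁ E₂ : Type*} [NormedAddCommGroup E] [NormedSpace ℝ E]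
  [NormedAddCommGroup E₁] [InnerProductSpace ℝ E₁] [NormedAddCommGroup E₂] [InnerProductSpace ℝ E₂]

/-- The multiplier `-ω` absorbs the `ω`-component of the Lagrange equation, which is thereby
equivalent to the Euler–Lagrange equation in `u`. -/
theorem energyDeriv_eq_smul_chargeDeriv_iff (L₁ : E →L[ℝ] E₁) (L₂ : E →L[ℝ] E₂) (D : E →L[ℝ] ℝ)
    (u : E) (ω : ℝ) : energyDeriv L₁ L₂ D u ω = (-ω) • chargeDeriv L₂ u ω ↔
      ∀ v, inner ℝ (L₁ u) (L₁ v) + D v = ω ^ 2 * inner ℝ (L₂ u) (L₂ v) := by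
  constructor
  · intro h v
    have := congrArg (fun T => T (v, (0 : ℝ))) h
    simp only [energyDeriv_apply, smul_apply, chargeDeriv_apply, smul_eq_mul] at this
    linarith
  · intro h
    refine ContinuousLinearMap.ext fun x => ?_
    obtain ⟨v, τ⟩ := x
    rw [energyDeriv_apply, smul_apply, chargeDeriv_apply, smul_eq_mul]
    linear_combination h v

/-- When `L u ≠ 0` every direction `v` is tangent to a curve in the level set of `-ω‖L u‖²`:
follow `u + s v` and adjust the frequency. -/
theorem IsConstrainedCriticalPoint.euler_lagrange {L₁ : E →L[ℝ] E₁} {L₂ : E →L[ℝ] E₂}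
    {D : E →L[ℝ] ℝ} {u : E} {ω : ℝ} {f : E × ℝ → ℝ} {M : Set (E × ℝ)}
    (hf : HasFDerivAt f (energyDeriv L₁ L₂ D u ω) (u, ω))
    (hM : M = {p | p.2 * ‖L₂ p.1‖ ^ 2 = ω * ‖L₂ u‖ ^ 2}) (hu : L₂ u ≠ 0)
    (h : IsConstrainedCriticalPoint f M (u, ω)) (v : E) :
    inner ℝ (L₁ u) (L₁ v) + D v = ω ^ 2 * inner ℝ (L₂ u) (L₂ v) := by
  set a : ℝ := ‖L₂ u‖ ^ 2 with ha
  set b : ℝ := inner ℝ (L₂ u) (L₂ v) with hb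
  have ha0 : a ≠ 0 := by
    have := norm_pos_iff.2 hu
    positivity
  let n : ℝ → ℝ := fun s => a + 2 * (s * b) + s ^ 2 * ‖L₂ v‖ ^ 2
  have hn : ∀ s, ‖L₂ (u + s • v)‖ ^ 2 = n s := fun s => by
    rw [map_add, map_smul, norm_add_sq_real, real_inner_smul_right, norm_smul, mul_pow,
      Real.norm_eq_abs, sq_abs]
  have hn0 : n 0 = a := by simp [n]
  have hnd : HasDerivAt n (2 * b) 0 := by
    have h1 : HasDerivAt (fun s : ℝ => a + 2 * (s * b)) (2 * (1 * b)) 0 :=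
      (((hasDerivAt_id (0 : ℝ)).mul_const b).const_mul 2).const_add a
    have h2 : HasDerivAt (fun s : ℝ => s ^ 2 * ‖L₂ v‖ ^ 2) (2 * 0 * ‖L₂ v‖ ^ 2) 0 :=
      ((hasDerivAt_pow 2 (0 : ℝ)).congr_deriv (by norm_num)).mul_const _
    exact (h1.add h2).congr_deriv (by ring)
  let γ : ℝ → E × ℝ := fun s => (u + s • v, ω * a / n s)
  have hγ1 : HasDerivAt (fun s : ℝ => u + s • v) v 0 := by
    have := ((hasDerivAt_id (0 : ℝ)).smul_const v).const_add u
    rwa [one_smul] at this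
  have hγ2 : HasDerivAt (fun s => ω * a / n s) (-(2 * ω * b) / a) 0 := by
    have := (hasDerivAt_const (0 : ℝ) (ω * a)).div hnd (by rwa [hn0])
    rw [hn0] at this
    refine this.congr_deriv ?_
    field_simp
    ring
  have hγd : HasDerivAt γ (v, -(2 * ω * b) / a) 0 := hγ1.prodMk hγ2
  have hγ0 : γ 0 = (u, ω) := by
    simp only [γ, hn0, zero_smul, add_zero, mul_div_cancel_right₀ ω ha0]
  have hγM : ∀ᶠ s in 𝓝 (0 : ℝ), γ s ∈ M := by
    have : ∀ᶠ s in 𝓝 (0 : ℝ), n s ≠ 0 :=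
      hnd.continuousAt.eventually_ne (by rwa [hn0])
    filter_upwards [this] with s hs
    rw [hM]
    change ω * a / n s * ‖L₂ (u + s • v)‖ ^ 2 = ω * a
    rw [hn, div_mul_cancel₀ _ hs]
  have h1 := h.2 γ hγ0 hγM hγd.differentiableAt
  have h2 : HasDerivAt (fun s => f (γ s))
      (energyDeriv L₁ L₂ D u ω (v, -(2 * ω * b) / a)) 0 :=
    HasFDerivAt.comp_hasDerivAt (f := γ) 0 (by rwa [hγ0]) hγd
  have h3 := h2.unique h1
  rw [energyDeriv_apply] at h3
  have h4 : ω * a * (-(2 * ω * b) / a) = -(2 * ω ^ 2 * b) := by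
    field_simp
  rw [← ha, h4, ← hb] at h3
  linarith

theorem euler_lagrange_of_dense (L₁ : E →L[ℝ] E₁) (L₂ : E →L[ℝ] E₂) (D : E →L[ℝ] ℝ)
    (u : E) (ω : ℝ) {S : Set E} (hS : Dense S)
    (h : ∀ v ∈ S, inner ℝ (L₁ u) (L₁ v) + D v = ω ^ 2 * inner ℝ (L₂ u) (L₂ v)) (v : E) :
    inner ℝ (L₁ u) (L₁ v) + D v = ω ^ 2 * inner ℝ (L₂ u) (L₂ v) := by
  have hc1 : Continuous fun v => inner ℝ (L₁ u) (L₁ v) + D v :=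
    (continuous_const.inner L₁.continuous).add D.continuous
  have hc2 : Continuous fun v => ω ^ 2 * inner ℝ (L₂ u) (L₂ v) :=
    continuous_const.mul (continuous_const.inner L₂.continuous)
  exact congrFun (hc1.ext_on hS hc2 h) v

variable {N : ℕ} {F : ℝ → ℝ} {A q K : ℝ}

/-- Testing against `C_c^∞` is the same as testing against `H¹`, by density. -/
theorem isWeakStationary_iff (hG : PowerGrowth (realPotential F) (realPotentialDeriv F) A q)
    (hK : SobolevBound N q K) (u : H1 N) (ω : ℝ) :
    IsWeakStationary (H1.val u) (fun x => realPotentialDeriv F (H1.val u x)) ω ↔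
      ∀ v, inner ℝ (H1.gradL2 N u) (H1.gradL2 N v) + hG.derivCLM hK u v =
        ω ^ 2 * inner ℝ (H1.toL2 N u) (H1.toL2 N v) := by
  have hu : LocallyIntegrable (H1.val u) volume := (H1.memLp_val u).locallyIntegrable one_le_two
  have hf := hG.locallyIntegrable_deriv_comp hK u
  have htest : ∀ (φ : Space N → ℝ) (h : IsTest φ),
      (∫ x, (H1.val u x * (-ω ^ 2 * φ x - Laplacian.laplacian φ x) +
        realPotentialDeriv F (H1.val u x) * φ x)) =
      inner ℝ (H1.gradL2 N u) (H1.gradL2 N (H1.ofTest h)) + hG.derivCLM hK u (H1.ofTest h) -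
        ω ^ 2 * inner ℝ (H1.toL2 N u) (H1.toL2 N (H1.ofTest h)) := by
    intro φ h
    have i1 : Integrable fun x => H1.val u x * φ x :=
      (h.integrable_smul hu).congr (by filter_upwards with x using mul_comm _ _)
    have i2 : Integrable fun x => H1.val u x * Laplacian.laplacian φ x :=
      (h.laplacian.integrable_smul hu).congr (by filter_upwards with x using mul_comm _ _)
    have i3 : Integrable fun x => realPotentialDeriv F (H1.val u x) * φ x :=
      (h.integrable_smul hf).congr (by filter_upwards with x using mul_comm _ _)
    have e3 : ∫ x, realPotentialDeriv F (H1.val u x) * H1.val (H1.ofTest h) x =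
        ∫ x, realPotentialDeriv F (H1.val u x) * φ x := by
      refine integral_congr_ae ?_
      filter_upwards [H1.val_ofTest h] with x hx
      rw [hx]
    have i12 : Integrable fun x => -ω ^ 2 * (H1.val u x * φ x) -
        H1.val u x * Laplacian.laplacian φ x := (i1.const_mul _).sub i2
    rw [H1.inner_gradL2_ofTest, H1.inner_toL2_ofTest, PowerGrowth.derivCLM_apply, e3]
    have e : ∀ x, H1.val u x * (-ω ^ 2 * φ x - Laplacian.laplacian φ x) +
        realPotentialDeriv F (H1.val u x) * φ x = (-ω ^ 2 * (H1.val u x * φ x) -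
        H1.val u x * Laplacian.laplacian φ x) + realPotentialDeriv F (H1.val u x) * φ x :=
      fun x => by ring
    simp only [e]
    rw [integral_add i12 i3, integral_sub (i1.const_mul _) i2, integral_const_mul]
    ring
  constructor
  · intro h
    refine euler_lagrange_of_dense (H1.gradL2 N) (H1.toL2 N) (hG.derivCLM hK u) u ω
      H1.dense_ofTest ?_
    rintro _ ⟨φ, hφ, rfl⟩
    have := htest φ hφ
    rw [h φ hφ] at this
    exact sub_eq_zero.1 this.symm
  · intro h φ hφ
    exact (htest φ hφ).trans (sub_eq_zero.2 (h (H1.ofTest hφ)))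

/-- The Lagrange equation with multiplier `-ω` characterizes the critical points of the energy
on the charge manifold. For `u = 0` it holds trivially. -/
theorem isConstrainedCriticalPoint_iff
    (hG : PowerGrowth (realPotential F) (realPotentialDeriv F) A q)
    (hK : SobolevBound N q K) (u : H1 N) (ω : ℝ) :
    IsConstrainedCriticalPoint (energy F) (chargeManifold N (charge (u, ω))) (u, ω) ↔
      energyDeriv (H1.gradL2 N) (H1.toL2 N) (hG.derivCLM hK u) u ω =
        (-ω) • chargeDeriv (H1.toL2 N) u ω := by
  constructor
  · intro h
    rw [energyDeriv_eq_smul_chargeDeriv_iff]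
    -- for `u = 0` no curve is needed, and the construction of one would divide by `‖u‖² = 0`
    by_cases hu : H1.toL2 N u = 0
    · have hz : H1.val u =ᵐ[volume] fun _ => 0 :=
        (Lp.eq_zero_iff_ae_eq_zero (f := H1.toL2 N u)).1 hu
      rw [← isWeakStationary_iff]
      intro φ _
      refine integral_eq_zero_of_ae ?_
      filter_upwards [hz] with x hx
      rw [hx, hG.deriv_zero, zero_mul, zero_mul, add_zero]
      rfl
    · refine h.euler_lagrange (hasFDerivAt_energy hG hK u ω) ?_ hu
      ext p
      simp only [chargeManifold, Set.mem_ofPred_eq, charge_eq, neg_inj]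
  · intro h
    have := isConstrainedCriticalPoint_of_eq_smul (f := energy F) (c := charge) (x := (u, ω))
      (r := -ω) (hasFDerivAt_energy hG hK u ω) (hasFDerivAt_charge u ω) h
    exact this

theorem differentiable_energy (hG : PowerGrowth (realPotential F) (realPotentialDeriv F) A q)
    (hK : SobolevBound N q K) : Differentiable ℝ (energy F : H1 N × ℝ → ℝ) := by
  rintro ⟨u, ω⟩
  exact (hasFDerivAt_energy hG hK u ω).differentiableAt

theorem differentiable_charge : Differentiable ℝ (charge : H1 N × ℝ → ℝ) := by
  rintro ⟨u, ω⟩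
  exact (hasFDerivAt_charge u ω).differentiableAt

theorem standingWave_iff_isConstrainedCriticalPoint
    (hG : PowerGrowth (realPotential F) (realPotentialDeriv F) A q)
    (hK : SobolevBound N q K) (u : H1 N) (ω : ℝ) :
    (HasFiniteEnergy F (standingWave u ω) ∧ IsSolution F (standingWave u ω)) ↔
      IsConstrainedCriticalPoint (energy F) (chargeManifold N (charge (u, ω))) (u, ω) :=
  (and_iff_right (hasFiniteEnergy_standingWave hG hK u ω)).trans <|
    (isSolution_standingWave_iff hG hK u ω).trans <|
    (isWeakStationary_iff hG hK u ω).trans <|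
    (energyDeriv_eq_smul_chargeDeriv_iff _ _ _ u ω).symm.trans
      (isConstrainedCriticalPoint_iff hG hK u ω).symm

theorem chargeDeriv_ne_zero {L : E →L[ℝ] E₂} {u : E} (hu : L u ≠ 0) (ω : ℝ) :
    chargeDeriv L u ω ≠ 0 := by
  intro h
  have h1 := congrArg (fun T => T ((0 : E), (1 : ℝ))) h
  simp only [chargeDeriv_apply, map_zero, inner_zero_right, mul_zero, mul_one, zero_sub,
    zero_apply, neg_eq_zero] at h1
  exact hu (norm_eq_zero.1 (pow_eq_zero_iff two_ne_zero |>.1 h1))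

/-- At a critical point of nonzero charge `dE = -ω dC` with `dC ≠ 0`, so `-ω` is the only Lagrange
multiplier. -/
theorem multiplier_iff (hG : PowerGrowth (realPotential F) (realPotentialDeriv F) A q)
    (hK : SobolevBound N q K) {u : H1 N} {ω : ℝ} (hC : charge (u, ω) ≠ 0)
    (h : IsConstrainedCriticalPoint (energy F) (chargeManifold N (charge (u, ω))) (u, ω))
    (μ : ℝ) : fderiv ℝ (energy F) (u, ω) = μ • fderiv ℝ charge (u, ω) ↔ μ = -ω := by
  have hu : H1.toL2 N u ≠ 0 := by
    intro h0
    have h1 := charge_eq (u, ω)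
    rw [show H1.toL2 N (u, ω).1 = 0 from h0, norm_zero] at h1
    exact hC (h1.trans (by norm_num))
  exact fderiv_eq_smul_fderiv_iff (f := energy F) (c := charge) (x := (u, ω))
    (hasFDerivAt_energy hG hK u ω) (hasFDerivAt_charge u ω) (chargeDeriv_ne_zero hu ω)
    ((isConstrainedCriticalPoint_iff hG hK u ω).1 h)

end Critical
end NKG
end

theorem mainTheorem6 (N : ℕ) (hN : 2 ≤ N) (F : ℝ → ℝ) (hF : ContDiff ℝ 2 F)
    (hF0 : NKG.Normalized F) (hFg : NKG.SubcriticalGrowth N F) :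
    (∀ v : NKG.H1 N, MeasureTheory.Integrable
      (fun x => NKG.potential F (NKG.H1.val v x : ℂ)) MeasureTheory.volume) ∧
    Differentiable ℝ (NKG.energy F : NKG.H1 N × ℝ → ℝ) ∧
    Differentiable ℝ (NKG.charge : NKG.H1 N × ℝ → ℝ) ∧
    ∀ (u : NKG.H1 N) (ω : ℝ), (u, ω) ∈ NKG.Y N →
      ((NKG.HasFiniteEnergy F (NKG.standingWave u ω) ∧
          NKG.IsSolution F (NKG.standingWave u ω)) ↔
        NKG.IsConstrainedCriticalPoint (NKG.energy F)
          (NKG.chargeManifold N (NKG.charge (u, ω))) (u, ω)) ∧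
      (NKG.charge (u, ω) ≠ 0 →
        NKG.IsConstrainedCriticalPoint (NKG.energy F)
          (NKG.chargeManifold N (NKG.charge (u, ω))) (u, ω) →
        ∀ μ : ℝ, fderiv ℝ (NKG.energy F) (u, ω) = μ • fderiv ℝ NKG.charge (u, ω) ↔
          μ = -ω) := by
  have hA := NKG.exists_powerGrowth hF hF0 hFg
  obtain ⟨A, q, hG, hq⟩ := hA
  have hB := NKG.H1.exists_integral_rpow_le hN hG.two_lt hq
  obtain ⟨K, -, hK⟩ := hB
  refine ⟨fun v => ?_, NKG.differentiable_energy hG hK, NKG.differentiable_charge,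
    fun u ω _ => ⟨NKG.standingWave_iff_isConstrainedCriticalPoint hG hK u ω,
      NKG.multiplier_iff hG hK⟩⟩
  simp only [NKG.potential_ofReal]
  exact hG.integrable_comp hK v
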